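/- Let $n\ge 1$ and $m\ge 0$ be integers, let $K$ be a field with a fixed embedding in $\mathbb{C}$, and let $H=\bigoplus_{i\ge 0}H^i$ be a finite-dimensional graded-commutative $K$-algebra, with $\beta_i=\dim_K H^i$. The case of interest is $H=H^*(X;K)$, $K=\mathbb{Q}$ or $\mathbb{C}$, for a smooth complex projective variety $X$ of complex dimension $m$; then $\beta_i$ is the $i$-th Betti number of $X$. Let $E(X,n)$ be the algebra of the Križ model built from $H$: the graded-commutative algebra generated over $H^{\otimes n}$ by exterior generators $G_{ij}$ ($1\le i\ne j\le n$) of odd degree $2m-1$, modulo the relations $$G_{ji}=G_{ij},\qquad p_j^*(x)G_{ij}=p_i^*(x)G_{ij}\ (i<j,\ x\in H),\qquad G_{ik}G_{jk}=G_{ij}G_{jk}-G_{ij}G_{ik}\ (i<j<k),$$ where $p_i^*:H\to H^{\otimes n}$ is the inclusion of the $i$-th factor. Let $E_q^k(X,n)$ be the span of the monomials with exactly $q$ factors $G_{ij}$ and total degree $k$. The symmetric group $\mathcal{S}_n$ acts on $E(X,n)$ by the algebra automorphisms with $\sigma(p_i^*(x))=p_{\sigma(i)}^*(x)$ and $\sigma(G_{ij})=G_{\sigma(i)\sigma(j)}$.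 Let $\{x_h\}$ be a basis of $H$ consisting of homogeneous elements, let $|x_h|$ be the degree of $x_h$, and let $E_{n-1}^{(n-1)(2m-1)+|x_h|}(n,h)\subseteq E_{n-1}^{(n-1)(2m-1)+|x_h|}(X,n)$ be the span of the monomials $p_1^*(x_h)\,G_{i_2 2}G_{i_3 3}\cdots G_{i_n n}$ with $1\le i_j<j$ for $j=2,\dots,n$. Let $c_n=(1,2,\dots,n)$, let $\varphi_n$ be the character of $\langle c_n\rangle$ with $\varphi_n(c_n)=e^{2\pi i/n}$, and let $\varepsilon_n$ be the sign character of $\mathcal{S}_n$. Then for every $h$ and every $i\ge 0$ the subspaces $E_{n-1}^{(n-1)(2m-1)+|x_h|}(n,h)$ and $E_{n-1}^{(n-1)(2m-1)+i}(X,n)$ are finite-dimensional and $\mathcal{S}_n$-stable, and their characters are $$\chi_{E_{n-1}^{(n-1)(2m-1)+|x_h|}(n,h)}=\varepsilon_n\,\mathrm{Ind}_{\langle c_n\rangle}^{\mathcal{S}_n}(\varphi_n),\qquad \chi_{E_{n-1}^{(n-1)(2m-1)+i}(X,n)}=\beta_i\cdot\varepsilon_n\,\mathrm{Ind}_{\langle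 c_n\rangle}^{\mathcal{S}_n}(\varphi_n).$$ -/

import Mathlib

noncomputable section

namespace Kriz

variable (K : Type*) [Field K] {H : Type*} [Ring H] [Algebra K H]

/-- A grading `𝓗` of an algebra `H` is graded commutative when `x y = (-1)^(|x||y|) y x` for all
homogeneous `x`, `y`. -/
def GradedCommutative (𝓗 : ℕ → Submodule K H) : Prop :=
  ∀ (a b : ℕ) (x y : H), x ∈ 𝓗 a → y ∈ 𝓗 b → x * y = (-1 : K) ^ (a * b) • (y * x)

/-- Generators of the Kriz model: the classes `p_i^*(x)` for `x ∈ H`, and the exterior generators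
`G_{ij}` for `i ≠ j`. The points are labelled by `Fin n`, that is `0, …, n - 1` in place of
`1, …, n`. -/
inductive Gen (H : Type*) (n : ℕ) : Type _
  | p (i : Fin n) (x : H) : Gen H n
  | G (i j : Fin n) (hij : i ≠ j) : Gen H n

/-- The class `p_i^*(x)` in the free algebra. -/
def fp (n : ℕ) (i : Fin n) (x : H) : FreeAlgebra K (Gen H n) := FreeAlgebra.ι K (Gen.p i x)

/-- The generator `G_{ij}` in the free algebra. -/
def fG (H : Type*) {n : ℕ} (i j : Fin n) (hij : i ≠ j) : FreeAlgebra K (Gen H n) :=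
  FreeAlgebra.ι K (Gen.G i j hij)

variable {K}

/-- Defining relations of the Kriz model. The first five present the graded tensor power `H^{⊗ n}`
(every `p_i^*` is a unital algebra map, and the images of `p_i^*` and `p_j^*`, `i ≠ j`, commute in
the graded sense); the next two say that the `G_{ij}` are odd exterior generators (of degree
`2m - 1`) with coefficients in `H^{⊗ n}`; the last three are
`G_{ji} = G_{ij}`, `p_j^*(x) G_{ij} = p_i^*(x) G_{ij}` for `i < j`, and
`G_{ik} G_{jk} = G_{ij} G_{jk} - G_{ij} G_{ik}` for `i < j < k`. -/
inductive Rel (𝓗 : ℕ → Submodule K H) (n : ℕ) :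
    FreeAlgebra K (Gen H n) → FreeAlgebra K (Gen H n) → Prop
  | p_add (i : Fin n) (x y : H) : Rel 𝓗 n (fp K n i (x + y)) (fp K n i x + fp K n i y)
  | p_smul (i : Fin n) (c : K) (x : H) : Rel 𝓗 n (fp K n i (c • x)) (c • fp K n i x)
  | p_one (i : Fin n) : Rel 𝓗 n (fp K n i 1) 1
  | p_mul (i : Fin n) (x y : H) : Rel 𝓗 n (fp K n i (x * y)) (fp K n i x * fp K n i y)
  | p_comm (i j : Fin n) (hij : i ≠ j) (a b : ℕ) (x y : H) (hx : x ∈ 𝓗 a) (hy : y ∈ 𝓗 b) :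
      Rel 𝓗 n (fp K n i x * fp K n j y) ((-1 : K) ^ (a * b) • (fp K n j y * fp K n i x))
  | G_p (i j : Fin n) (hij : i ≠ j) (l : Fin n) (a : ℕ) (x : H) (hx : x ∈ 𝓗 a) :
      Rel 𝓗 n (fG K H i j hij * fp K n l x) ((-1 : K) ^ a • (fp K n l x * fG K H i j hij))
  | G_G (i j : Fin n) (hij : i ≠ j) (k l : Fin n) (hkl : k ≠ l) :
      Rel 𝓗 n (fG K H i j hij * fG K H k l hkl) (-(fG K H k l hkl * fG K H i j hij))
  | G_symm (i j : Fin n) (hij : i ≠ j) : Rel 𝓗 n (fG K H j i hij.symm) (fG K H i j hij)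
  | p_G (i j : Fin n) (hij : i < j) (x : H) :
      Rel 𝓗 n (fp K n j x * fG K H i j hij.ne) (fp K n i x * fG K H i j hij.ne)
  | arnold (i j k : Fin n) (hij : i < j) (hjk : j < k) :
      Rel 𝓗 n (fG K H i k (hij.trans hjk).ne * fG K H j k hjk.ne)
        (fG K H i j hij.ne * fG K H j k hjk.ne - fG K H i j hij.ne * fG K H i k (hij.trans hjk).ne)

/-- The algebra `E(X, n)` underlying the Kriz model, for the cohomology algebra `H = H^*(X)` with
grading `𝓗`. -/
abbrev Model (𝓗 : ℕ → Submodule K H) (n : ℕ) : Type _ := RingQuot (Rel 𝓗 n)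

variable (𝓗 : ℕ → Submodule K H) {n : ℕ}

/-- The class `p_i^*(x)` in the Kriz model. -/
def p (i : Fin n) (x : H) : Model 𝓗 n := RingQuot.mkAlgHom K (Rel 𝓗 n) (fp K n i x)

/-- The exterior generator `G_{ij}` of the Kriz model. -/
def G (i j : Fin n) (hij : i ≠ j) : Model 𝓗 n := RingQuot.mkAlgHom K (Rel 𝓗 n) (fG K H i j hij)

theorem mk_rel {a b : FreeAlgebra K (Gen H n)} (h : Rel 𝓗 n a b) :
    RingQuot.mkAlgHom K (Rel 𝓗 n) a = RingQuot.mkAlgHom K (Rel 𝓗 n) b :=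
  RingQuot.mkAlgHom_rel K h

theorem G_symm (i j : Fin n) (hij : i ≠ j) : G 𝓗 j i hij.symm = G 𝓗 i j hij :=
  mk_rel 𝓗 (.G_symm i j hij)

theorem G_G (i j : Fin n) (hij : i ≠ j) (k l : Fin n) (hkl : k ≠ l) :
    G 𝓗 i j hij * G 𝓗 k l hkl = -(G 𝓗 k l hkl * G 𝓗 i j hij) := by
  simpa [G] using mk_rel 𝓗 (.G_G i j hij k l hkl)

theorem p_G (i j : Fin n) (hij : i ≠ j) (x : H) :
    p 𝓗 j x * G 𝓗 i j hij = p 𝓗 i x * G 𝓗 i j hij := by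
  rcases lt_or_gt_of_ne hij with h | h
  · simpa [G, p] using mk_rel 𝓗 (.p_G i j h x)
  · rw [← G_symm 𝓗 i j hij]
    simpa [G, p] using (mk_rel 𝓗 (.p_G j i h x)).symm

theorem arnold (i j k : Fin n) (hij : i ≠ j) (hjk : j ≠ k) (hik : i ≠ k) :
    G 𝓗 i k hik * G 𝓗 j k hjk = G 𝓗 i j hij * G 𝓗 j k hjk - G 𝓗 i j hij * G 𝓗 i k hik := by
  have key : ∀ (i j k : Fin n) (hij : i < j) (hjk : j < k),
      G 𝓗 i k (hij.trans hjk).ne * G 𝓗 j k hjk.ne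
        = G 𝓗 i j hij.ne * G 𝓗 j k hjk.ne - G 𝓗 i j hij.ne * G 𝓗 i k (hij.trans hjk).ne := by
    intro i j k hij hjk
    simpa [G] using mk_rel 𝓗 (.arnold i j k hij hjk)
  have s := fun i j hij => G_symm 𝓗 (n := n) i j hij
  have h1 := G_G 𝓗 j k hjk i j hij
  have h2 := G_G 𝓗 i k hik i j hij
  have h3 := G_G 𝓗 j k hjk i k hik
  have key' : ∀ (a b c : Fin n) (hab : a < b) (hbc : b < c) (A B C : Model 𝓗 n),
      G 𝓗 a b hab.ne = A → G 𝓗 b c hbc.ne = B → G 𝓗 a c (hab.trans hbc).ne = C →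
        C * B = A * B - A * C := by
    rintro a b c hab hbc _ _ _ rfl rfl rfl
    exact key a b c hab hbc
  have s1 := s i j hij
  have s2 := s j k hjk
  have s3 := s i k hik
  have aux : ∀ A B C : Model 𝓗 n, B * A = -(A * B) → C * A = -(A * C) → B * C = -(C * B) →
      (C * B = A * B - A * C ∨ B * C = A * C - A * B ∨ B * A = C * A - C * B ∨
        C * A = B * A - B * C ∨ A * C = B * C - B * A ∨ A * B = C * B - C * A) →
      C * B = A * B - A * C := by
    intro A B C h1 h2 h3 h
    rw [h1, h2, h3] at h
    generalize A * B = x at *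
    generalize A * C = y at *
    generalize C * B = z at *
    grind
  refine aux _ _ _ h1 h2 h3 ?_
  rcases lt_or_gt_of_ne hij with l1 | l1 <;> rcases lt_or_gt_of_ne hjk with l2 | l2 <;>
    rcases lt_or_gt_of_ne hik with l3 | l3
  · exact .inl (key' i j k l1 l2 _ _ _ rfl rfl rfl)
  · exact absurd (l1.trans l2) l3.asymm
  · have := key' i k j l3 l2 _ _ _ rfl s2 rfl
    grind
  · have := key' k i j l3 l1 _ _ _ s3 rfl s2
    grind
  · have := key' j i k l1 l3 _ _ _ s1 rfl rfl
    grind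
  · have := key' j k i l2 l3 _ _ _ rfl s3 s1
    grind
  · exact absurd (l2.trans l1) l3.asymm
  · have := key' k j i l2 l1 _ _ _ s2 s1 s3
    grind

/-- The endomorphism of the Kriz model given by a permutation `σ` of the points:
`p_i^*(x) ↦ p_{σ(i)}^*(x)`, `G_{ij} ↦ G_{σ(i)σ(j)}`. -/
def permHom (σ : Equiv.Perm (Fin n)) : Model 𝓗 n →ₐ[K] Model 𝓗 n :=
  RingQuot.liftAlgHom K ⟨FreeAlgebra.lift K fun g => match g with
    | .p i x => p 𝓗 (σ i) x
    | .G i j hij => G 𝓗 (σ i) (σ j) (σ.injective.ne hij), by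
    intro a b h
    cases h with
    | p_add i x y => simpa [fp, p] using mk_rel 𝓗 (.p_add (σ i) x y)
    | p_smul i c x => simpa [fp, p] using mk_rel 𝓗 (.p_smul (σ i) c x)
    | p_one i => simpa [fp, p] using mk_rel 𝓗 (.p_one (σ i))
    | p_mul i x y => simpa [fp, p] using mk_rel 𝓗 (.p_mul (σ i) x y)
    | p_comm i j hij a b x y hx hy =>
      simpa [fp, p] using mk_rel 𝓗 (.p_comm (σ i) (σ j) (σ.injective.ne hij) a b x y hx hy)
    | G_p i j hij l a x hx =>
      simpa [fp, p, fG, G] using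
        mk_rel 𝓗 (.G_p (σ i) (σ j) (σ.injective.ne hij) (σ l) a x hx)
    | G_G i j hij k l hkl =>
      simpa [fG] using G_G 𝓗 (σ i) (σ j) (σ.injective.ne hij) (σ k) (σ l) (σ.injective.ne hkl)
    | G_symm i j hij => simpa [fG] using G_symm 𝓗 (σ i) (σ j) (σ.injective.ne hij)
    | p_G i j hij x =>
      simpa [fG, fp] using p_G 𝓗 (σ i) (σ j) (σ.injective.ne hij.ne) x
    | arnold i j k hij hjk =>
      simpa [fG] using arnold 𝓗 (σ i) (σ j) (σ k) (σ.injective.ne hij.ne)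
        (σ.injective.ne hjk.ne) (σ.injective.ne (hij.trans hjk).ne)⟩

@[simp]
theorem permHom_p (σ : Equiv.Perm (Fin n)) (i : Fin n) (x : H) :
    permHom 𝓗 σ (p 𝓗 i x) = p 𝓗 (σ i) x := by
  simp [permHom, p, fp]

@[simp]
theorem permHom_G (σ : Equiv.Perm (Fin n)) (i j : Fin n) (hij : i ≠ j) :
    permHom 𝓗 σ (G 𝓗 i j hij) = G 𝓗 (σ i) (σ j) (σ.injective.ne hij) := by
  simp [permHom, G, fG]

theorem algHom_ext {f g : Model 𝓗 n →ₐ[K] Model 𝓗 n}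
    (hp : ∀ i x, f (p 𝓗 i x) = g (p 𝓗 i x))
    (hG : ∀ i j hij, f (G 𝓗 i j hij) = g (G 𝓗 i j hij)) : f = g := by
  apply RingQuot.ringQuot_ext'
  apply FreeAlgebra.hom_ext
  funext a
  cases a with
  | p i x => exact hp i x
  | G i j hij => exact hG i j hij

/-- The representation of the symmetric group on the Kriz model, by algebra automorphisms. -/
def rep (n : ℕ) : Representation K (Equiv.Perm (Fin n)) (Model 𝓗 n) :=
  (AlgHom.toEnd (R := K) (A := Model 𝓗 n)).comp
    { toFun := permHom 𝓗
      map_one' := algHom_ext 𝓗 (by simp) (by simp)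
      map_mul' := fun σ τ => algHom_ext 𝓗 (by simp) (by simp) }

/-- The bigraded component `E_q^k(X, n)`, for `X` of complex dimension `m`: it is spanned by the
monomials `p_1^*(y_1) ⋯ p_n^*(y_n) G_{i_1 j_1} ⋯ G_{i_q j_q}` with homogeneous `y_i ∈ H`, with
exactly `q` exterior generators, each of degree `2m - 1`, and of total degree `k`. -/
def component (n m q : ℕ) (k : ℤ) : Submodule K (Model 𝓗 n) :=
  Submodule.span K {z | ∃ (d : Fin n → ℕ) (y : Fin n → H)
    (l : List {e : Fin n × Fin n // e.1 ≠ e.2}),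
    (∀ i, y i ∈ 𝓗 (d i)) ∧ l.length = q ∧ (∑ i, (d i : ℤ)) + q * (2 * (m : ℤ) - 1) = k ∧
    z = (List.ofFn fun i => p 𝓗 i (y i)).prod * (l.map fun e => G 𝓗 e.1.1 e.1.2 e.2).prod}

/-- The exterior monomial `G_{i_1 j_1} G_{i_2 j_2} ⋯ G_{i_q j_q}`, `j_1 < ⋯ < j_q`, of a monotonic
forest. The forest is given by a map `f`: a vertex `j` with `f j < j` is joined to its parent `f j`
(and contributes the factor `G_{f(j) j}`), the other vertices are the roots (no factor). -/
def forestMonomial (f : Fin n → Fin n) : Model 𝓗 n :=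
  (List.ofFn fun j => if h : f j < j then G 𝓗 (f j) j h.ne else 1).prod

/-- The subspace `E_{n-1}(n, h)` whose type is the single `n`-vertex tree marked with `x = x_h`:
the span of the canonical monomials `p_1^*(x) G_{i_2 2} G_{i_3 3} ⋯ G_{i_n n}`, `i_j < j`. -/
def treeSpace (n : ℕ) (hn : 1 ≤ n) (x : H) : Submodule K (Model 𝓗 n) :=
  Submodule.span K {z | ∃ f : Fin n → Fin n, (∀ j, j ≠ ⟨0, hn⟩ → f j < j) ∧
    z = p 𝓗 ⟨0, hn⟩ x * forestMonomial 𝓗 f}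

variable {𝓗}

/-- The subspace `W` of the representation `ρ` is finite-dimensional and stable under the group, and
the resulting subrepresentation has the complex valued character `χ`. -/
def HasCharacter {V Γ : Type*} [Group Γ] [AddCommGroup V] [Module K V] [Algebra K ℂ]
    (ρ : Representation K Γ V) (W : Submodule K V) (χ : Γ → ℂ) : Prop :=
  Module.Finite K W ∧ ∃ S : Subrepresentation ρ, S.toSubmodule = W ∧
    ∀ σ, algebraMap K ℂ (S.toRepresentation.character σ) = χ σ

/-- The cyclic subgroup `⟨c_n⟩`, where `c_n` is the `n`-cycle `(1, 2, …, n)`. -/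
abbrev cyc (n : ℕ) : Subgroup (Equiv.Perm (Fin n)) := Subgroup.zpowers (finRotate n)

theorem orderOf_finRotate (n : ℕ) (hn : 1 ≤ n) : orderOf (finRotate n) = n := by
  rcases Nat.lt_or_ge n 2 with h | h
  · obtain rfl : n = 1 := by omega
    rw [orderOf_eq_one_iff]
    exact Subsingleton.elim _ _
  · rw [(isCycle_finRotate_of_le h).orderOf, support_finRotate_of_le h]
    simp

/-- The complex number `e^{2πi/n}`, as a unit. -/
def zeta (n : ℕ) : ℂˣ :=
  Units.mk0 (Complex.exp (2 * Real.pi * Complex.I / n)) (Complex.exp_ne_zero _)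

theorem zeta_pow (n : ℕ) (hn : 1 ≤ n) : zeta n ^ n = 1 := by
  have hn' : (n : ℂ) ≠ 0 := by exact_mod_cast (by omega : n ≠ 0)
  ext
  simp only [zeta, Units.val_pow_eq_pow_val, Units.val_mk0, Units.val_one]
  rw [← Complex.exp_nat_mul, mul_div_cancel₀ _ hn', Complex.exp_two_pi_mul_I]

/-- The character `φ_n : ⟨c_n⟩ → ℂ^*` with `φ_n(c_n) = e^{2πi/n}`. -/
def phi (n : ℕ) (hn : 1 ≤ n) : cyc n →* ℂˣ :=
  monoidHomOfForallMemZpowers (g := ⟨finRotate n, Subgroup.mem_zpowers _⟩) (g' := zeta n)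
    (by
      rintro ⟨_, k, rfl⟩
      exact ⟨k, Subtype.ext rfl⟩)
    (by
      rw [← Subgroup.orderOf_coe, orderOf_finRotate n hn]
      exact orderOf_dvd_of_pow_eq_one (zeta_pow n hn))

theorem phi_gen (n : ℕ) (hn : 1 ≤ n) :
    (phi n hn ⟨finRotate n, Subgroup.mem_zpowers _⟩ : ℂ)
      = Complex.exp (2 * Real.pi * Complex.I / n) := by
  simp [phi, monoidHomOfForallMemZpowers_apply_gen, zeta]

/-- The one-dimensional representation of `⟨c_n⟩` on `ℂ` with character `φ_n`. -/
def phiRep (n : ℕ) (hn : 1 ≤ n) : Representation ℂ (cyc n) ℂ :=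
  ((algebraMap ℂ (Module.End ℂ ℂ)).toMonoidHom.comp (Units.coeHom ℂ)).comp (phi n hn)

/-- The character `ε_n · Ind_{⟨c_n⟩}^{S_n}(φ_n)`, where `ε_n` is the sign character. -/
def topCharacter (n : ℕ) (hn : 1 ≤ n) (σ : Equiv.Perm (Fin n)) : ℂ :=
  ((Equiv.Perm.sign σ : ℤ) : ℂ) *
    (Representation.ind (cyc n).subtype (phiRep n hn)).character σ

end Kriz
end

noncomputable section

namespace Kriz

open Finset
open scoped TensorProduct

universe u

/-! Write n = N + 1. A product of N exterior generators reduces, by the Arnold relation, to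
monomials of increasing trees (each nonroot vertex joined to a smaller one), and there are N! of
these. On a tree monomial the relation p_j(x) G_ij = p_i(x) G_ij slides every cohomology label to
the root. So the top component in degree i is spanned by the products p_0(y) T with y in a basis of
H^i and T a tree, and `treeSpace` is the case of a single mark (`component_eq`, `treeSpace_eq`).
These products are independent because the model acts on H ⊗ M, where M is a module over the Arnold
algebra built one vertex at a time (`exists_arnoldModule`, `linearIndependent_p_mul_treeProd`).

A permutation transforms the trees by a matrix that does not depend on the mark
(`exists_permMatrix`). The character of the component is therefore β_i times that of a single mark,
and a representation of dimension N! remains to be identified.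

Over ℂ, let r be the weighted sum of the paths obtained by cutting the cycle 0, 1, …, N at one edge
(`cycSum`, with t = ζ⁻¹). After a twist by the sign, c_n acts on r by ζ (`IsArnold.rotate_cycSum`).
The main point is that r generates everything (`IsArnold.mul_treeProd_mem`). The recursion
`IsArnold.cycSum_cons` gives r = t y - φ y, where y has one vertex fewer in its cycle and φ is, up
to sign, a permutation with φ^k y = y for some k ≤ N. As t^k ≠ 1, y lies in the submodule generated
by r. Repetition opens the cycle into a path, and paths span the tree monomials. Frobenius
reciprocity then maps Ind φ_n onto the twisted representation, and since dim Ind φ_n ≤ N! this map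
is an isomorphism. -/

/-- A family of ring elements indexed by pairs that satisfies the relations of the Arnold algebra:
symmetry, anticommutativity and the three term relation. -/
structure IsArnold {α R : Type*} [Ring R] (g : α → α → R) : Prop where
  symm : ∀ i j, g i j = g j i
  diag : ∀ i, g i i = 0
  anticomm : ∀ i j k l, g i j * g k l = -(g k l * g i j)
  cyclic : ∀ i j k, g i j * g j k + g j k * g k i + g k i * g i j = 0

/-! ### Reduction of exterior monomials to monotonic forests -/

section Forests

variable {R : Type*} [Ring R]

/-- Each factor passed costs at most a sign. The total sign is left undetermined: the later uses are
membership in spans and identities in which it cancels. -/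
theorem mul_prod_ofFn {m : ℕ} (F : Fin m → R) (a : R) (k : Fin m)
    (h : ∀ i, a * F i = F i * a ∨ a * F i = -(F i * a)) :
    a * (List.ofFn F).prod = (List.ofFn (Function.update F k (a * F k))).prod ∨
      a * (List.ofFn F).prod = -(List.ofFn (Function.update F k (a * F k))).prod := by
  induction m with
  | zero => exact k.elim0
  | succ m ih =>
    refine Fin.cases ?_ (fun k => ?_) k
    · left
      simp [List.ofFn_succ, mul_assoc]
    · have e : (fun i : Fin m => Function.update F k.succ (a * F k.succ) i.succ) =
          Function.update (fun i : Fin m => F i.succ) k (a * F k.succ) := by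
        funext i
        by_cases hi : i = k
        · subst hi; simp
        · rw [Function.update_of_ne (by simpa using hi), Function.update_of_ne hi]
      have e0 : Function.update F k.succ (a * F k.succ) 0 = F 0 :=
        Function.update_of_ne (Fin.succ_ne_zero k).symm _ _
      rw [List.ofFn_succ, List.ofFn_succ, List.prod_cons, List.prod_cons, e, e0, ← mul_assoc]
      rcases ih (fun i => F i.succ) k (fun i => h i.succ) with h1 | h1 <;>
        rcases h 0 with h2 | h2 <;> rw [h2]
      · left; rw [mul_assoc, h1]
      · right; rw [neg_mul, mul_assoc, h1]
      · right; rw [mul_assoc, h1, mul_neg]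
      · left; rw [neg_mul, mul_assoc, h1, mul_neg, neg_neg]

/-- The exterior monomial of a monotonic forest, for an arbitrary system of generators `g`. -/
def forestProd {n : ℕ} (g : Fin n → Fin n → R) (f : Fin n → Fin n) : R :=
  (List.ofFn fun j => if f j < j then g (f j) j else 1).prod

variable {n : ℕ} {g : Fin n → Fin n → R}

namespace IsArnold

/-- The three term relation with a repeated index already forces squares to vanish, with no division
by 2. -/
theorem sq {α : Type*} {g : α → α → R} (hg : IsArnold g) (i j : α) : g i j * g i j = 0 := by
  have h := hg.cyclic i i j
  rwa [hg.diag, hg.symm j i, zero_mul, mul_zero, zero_add, add_zero] at h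

theorem mul_forestProd (hg : IsArnold g) {f : Fin n → Fin n} {a b : Fin n} (hab : a < b)
    (hb : ¬ f b < b) :
    g a b * forestProd g f = forestProd g (Function.update f b a) ∨
      g a b * forestProd g f = -forestProd g (Function.update f b a) := by
  have h := mul_prod_ofFn (fun j => if f j < j then g (f j) j else 1) (g a b) b (by
    intro i
    by_cases hi : f i < i
    · right; simpa [hi] using hg.anticomm _ _ _ _
    · left; simp [hi])
  have e : Function.update (fun j => if f j < j then g (f j) j else 1) b
      (g a b * (if f b < b then g (f b) b else 1)) =
      fun j => if Function.update f b a j < j then g (Function.update f b a j) j else 1 := by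
    funext j
    by_cases hj : j = b
    · subst hj; simp [hb, hab]
    · simp [hj]
  simp only [e] at h
  exact h

theorem forestProd_eq (hg : IsArnold g) {f : Fin n → Fin n} {b : Fin n} (hb : f b < b) :
    forestProd g f = g (f b) b * forestProd g (Function.update f b b) ∨
      forestProd g f = -(g (f b) b * forestProd g (Function.update f b b)) := by
  have h := hg.mul_forestProd (f := Function.update f b b) hb (by simp)
  rw [Function.update_idem, Function.update_eq_self] at h
  rcases h with h | h
  · left; exact h.symm
  · right; rw [h, neg_neg]

/-- The three term relation, solved for products with a common target. -/
theorem mul_common {α : Type*} {g : α → α → R} (hg : IsArnold g) (a c b : α) :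
    g a b * g c b = g a c * g c b - g a c * g a b := by
  have h := hg.cyclic a c b
  rw [hg.symm b a, hg.anticomm a b a c, hg.anticomm c b a b] at h
  rw [eq_comm, ← sub_eq_zero, ← h]
  abel

end IsArnold

/-- The number of edges of a monotonic forest. -/
def edgeCount (f : Fin n → Fin n) : ℕ := #{j | f j < j}

theorem edgeCount_update {f : Fin n → Fin n} {a b : Fin n} (hab : a < b) (hb : ¬ f b < b) :
    edgeCount (Function.update f b a) = edgeCount f + 1 := by
  unfold edgeCount
  rw [← card_insert_of_notMem (a := b) (s := {j | f j < j}) (by simpa using hb)]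
  congr 1
  ext j
  by_cases hj : j = b
  · subst hj; simp [hab]
  · simp [hj]

variable (K : Type*) [Field K] [Algebra K R]

/-- The span of the monomials of the monotonic forests with `q` edges. -/
def forestSpan (g : Fin n → Fin n → R) (q : ℕ) : Submodule K R :=
  Submodule.span K {z | ∃ f, edgeCount f = q ∧ z = forestProd g f}

variable {K}

theorem mem_forestSpan {q : ℕ} (f : Fin n → Fin n) (hf : edgeCount f = q) :
    forestProd g f ∈ forestSpan K g q := Submodule.subset_span ⟨f, hf, rfl⟩

theorem mem_of_eq_or_neg {S : Submodule K R} {x y : R} (h : x = y ∨ x = -y) (hy : y ∈ S) :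
    x ∈ S := by
  rcases h with rfl | rfl
  · exact hy
  · exact S.neg_mem hy

/-- Let a < b. If b is a root, the new factor is a new edge. If b has a parent c, then g_ab g_cb =
g_ac g_cb - g_ac g_ab leaves one edge into b and a factor g_ac with both ends below b, so induction
on the larger end applies. -/
theorem IsArnold.mul_mem_forestSpan (hg : IsArnold g) (a b : Fin n) {q : ℕ} {z : R}
    (hz : z ∈ forestSpan K g q) : g a b * z ∈ forestSpan K g (q + 1) := by
  have key : ∀ (b a : Fin n), a < b → ∀ f : Fin n → Fin n, edgeCount f = q →
      g a b * forestProd g f ∈ forestSpan K g (q + 1) := by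
    intro b
    induction b using WellFoundedLT.induction with
    | ind b ih =>
      intro a hab f hf
      have ih' : ∀ c d : Fin n, c < b → d < b → ∀ f : Fin n → Fin n, edgeCount f = q →
          g c d * forestProd g f ∈ forestSpan K g (q + 1) := by
        intro c d hc hd f hf
        rcases lt_trichotomy c d with h | rfl | h
        · exact ih d hd c h f hf
        · rw [hg.diag, zero_mul]; exact Submodule.zero_mem _
        · rw [hg.symm]; exact ih c hc d h f hf
      by_cases hb : f b < b
      · set f' := Function.update f b b with hf'
        have hf'b : ¬ f' b < b := by simp [hf']
        have hcount : edgeCount f' + 1 = q := by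
          rw [← hf, ← edgeCount_update hb hf'b, hf', Function.update_idem,
            Function.update_eq_self]
        have e1 : g (f b) b * forestProd g f' = forestProd g f ∨
            g (f b) b * forestProd g f' = -forestProd g f := by
          have := hg.mul_forestProd hb hf'b
          rwa [hf', Function.update_idem, Function.update_eq_self] at this
        have h1 : g a b * (g (f b) b * forestProd g f') ∈ forestSpan K g (q + 1) := by
          rw [← mul_assoc, hg.mul_common, sub_mul, mul_assoc, mul_assoc]
          refine Submodule.sub_mem _ ?_ ?_
          · rcases e1 with e | e <;> rw [e]
            · exact ih' _ _ hab hb f hf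
            · rw [mul_neg]; exact Submodule.neg_mem _ (ih' _ _ hab hb f hf)
          · have hc := (edgeCount_update hab hf'b).trans hcount
            rcases hg.mul_forestProd hab hf'b with e | e <;> rw [e]
            · exact ih' _ _ hab hb _ hc
            · rw [mul_neg]; exact Submodule.neg_mem _ (ih' _ _ hab hb _ hc)
        rcases e1 with e | e <;> rw [e] at h1
        · exact h1
        · rw [mul_neg] at h1; exact (Submodule.neg_mem_iff _).1 h1
      · refine mem_of_eq_or_neg (hg.mul_forestProd hab hb) (mem_forestSpan _ ?_)
        rw [edgeCount_update hab hb, hf]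
  induction hz using Submodule.span_induction with
  | zero => rw [mul_zero]; exact Submodule.zero_mem _
  | add x y _ _ hx hy => rw [mul_add]; exact Submodule.add_mem _ hx hy
  | smul c x _ hx => rw [mul_smul_comm]; exact Submodule.smul_mem _ _ hx
  | mem x hx =>
    obtain ⟨f, hf, rfl⟩ := hx
    rcases lt_trichotomy a b with h | rfl | h
    · exact key b a h f hf
    · rw [hg.diag, zero_mul]; exact Submodule.zero_mem _
    · rw [hg.symm]; exact key a b h f hf

theorem IsArnold.list_prod_mem_forestSpan (hg : IsArnold g) (l : List (Fin n × Fin n)) :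
    (l.map fun e => g e.1 e.2).prod ∈ forestSpan K g l.length := by
  induction l with
  | nil =>
    have e : forestProd g (id : Fin n → Fin n) = 1 := by
      simp [forestProd]
    simpa [e] using mem_forestSpan (K := K) (g := g) (id : Fin n → Fin n)
      (q := 0) (by simp [edgeCount])
  | cons e l ih => simpa using hg.mul_mem_forestSpan e.1 e.2 ih

end Forests

/-! ### Increasing trees and labels on them -/

section Trees

variable {R : Type*} [Ring R] {N : ℕ} {g : Fin (N + 1) → Fin (N + 1) → R}

/-- The increasing trees on the vertices `0, …, N`: the vertex `j + 1` has a parent in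
`{0, …, j}`. -/
abbrev IncTree (N : ℕ) : Type := ∀ j : Fin N, Fin (j + 1)

theorem card_incTree (N : ℕ) : Fintype.card (IncTree N) = N.factorial := by
  simp [IncTree, Fintype.card_pi, Fin.prod_univ_eq_prod_range (fun i => i + 1) N,
    Finset.prod_range_add_one_eq_factorial]

/-- The parent map of an increasing tree. -/
def IncTree.parent (f : IncTree N) (j : Fin N) : Fin (N + 1) := (f j).castLE (by omega)

/-- The parent map of an increasing tree, with the root as its own parent. -/
def IncTree.toFun (f : IncTree N) : Fin (N + 1) → Fin (N + 1) := Fin.cons 0 f.parent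

theorem IncTree.parent_lt (f : IncTree N) (j : Fin N) : f.parent j < j.succ := by
  have := (f j).2
  simp only [IncTree.parent, Fin.lt_def, Fin.val_castLE, Fin.val_succ]
  omega

theorem IncTree.toFun_lt (f : IncTree N) (j : Fin (N + 1)) (hj : j ≠ 0) : f.toFun j < j := by
  obtain ⟨j, rfl⟩ := Fin.exists_succ_eq.2 hj
  simpa [IncTree.toFun] using f.parent_lt j

/-- The exterior monomial of an increasing tree. -/
def treeProd (g : Fin (N + 1) → Fin (N + 1) → R) (f : IncTree N) : R :=
  (List.ofFn fun j => g (f.parent j) j.succ).prod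

theorem forestProd_toFun (f : IncTree N) : forestProd g f.toFun = treeProd g f := by
  unfold forestProd treeProd
  rw [List.ofFn_succ, List.prod_cons]
  simp [IncTree.toFun, f.parent_lt]

theorem exists_incTree (f : Fin (N + 1) → Fin (N + 1)) (hf : ∀ j, j ≠ 0 → f j < j) :
    ∃ f' : IncTree N, forestProd g f = treeProd g f' := by
  refine ⟨fun j => ⟨f j.succ, ?_⟩, ?_⟩
  · have := hf j.succ (Fin.succ_ne_zero j)
    rwa [Fin.lt_def, Fin.val_succ] at this
  · unfold forestProd treeProd
    rw [List.ofFn_succ, List.prod_cons, if_neg (by simp), one_mul]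
    congr 2
    funext j
    rw [if_pos (hf _ (Fin.succ_ne_zero j))]
    rfl

/-- Vertex 0 has no smaller vertex, so only the other N vertices can have a parent, and N edges use
all of them. -/
theorem edgeCount_eq {f : Fin (N + 1) → Fin (N + 1)} (hf : edgeCount f = N) (j : Fin (N + 1))
    (hj : j ≠ 0) : f j < j := by
  have h1 : ({j | f j < j} : Finset (Fin (N + 1))) ⊆ univ.erase 0 := by
    intro j hj
    simp only [mem_filter, mem_univ, true_and] at hj
    simp only [mem_erase, mem_univ, and_true]
    exact Fin.ne_zero_of_lt hj
  have h2 := eq_of_subset_of_card_le h1 (by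
    change _ ≤ edgeCount f
    rw [hf]; simp)
  have : j ∈ univ.erase (0 : Fin (N + 1)) := by simp [hj]
  rw [← h2] at this
  simpa using this

/-- The edge from j to its parent can be pulled to the front, where it exchanges X j for the label
at the parent; descending along parents reaches the root. -/
theorem IsArnold.mul_treeProd {X : Fin (N + 1) → R} (hg : IsArnold g)
    (hX : ∀ i j, X j * g i j = X i * g i j) (f : IncTree N) (j : Fin (N + 1)) :
    X j * treeProd g f = X 0 * treeProd g f := by
  rw [← forestProd_toFun]
  induction j using WellFoundedLT.induction with
  | ind j ih =>
    by_cases hj : j = 0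
    · rw [hj]
    · have h := f.toFun_lt j hj
      rw [← ih _ h]
      rcases hg.forestProd_eq h with e | e <;> rw [e]
      · rw [← mul_assoc, hX, mul_assoc]
      · rw [mul_neg, ← mul_assoc, hX, mul_assoc, mul_neg]

variable (K : Type*) [Field K] [Algebra K R]

theorem forestSpan_le :
    forestSpan K g N ≤ Submodule.span K (Set.range (treeProd g)) := by
  rw [forestSpan, Submodule.span_le]
  rintro _ ⟨f, hf, rfl⟩
  obtain ⟨f', e⟩ := exists_incTree (g := g) f (edgeCount_eq hf)
  rw [e]
  exact Submodule.subset_span ⟨f', rfl⟩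

end Trees

/-! ### Path monomials and weighted cyclic sums -/

section Paths

variable {α R : Type*} [Ring R]

/-- The monomial of the path through the vertices of a list. -/
def pathProd (g : α → α → R) : List α → R
  | [] => 1
  | [_] => 1
  | a :: b :: l => g a b * pathProd g (b :: l)

variable {g : α → α → R}

@[simp] theorem pathProd_singleton (a : α) : pathProd g [a] = 1 := rfl

@[simp] theorem pathProd_cons_cons (a b : α) (l : List α) :
    pathProd g (a :: b :: l) = g a b * pathProd g (b :: l) := rfl

theorem pathProd_append (l : List α) (a : α) (m : List α) :
    pathProd g (l ++ a :: m) = pathProd g (l ++ [a]) * pathProd g (a :: m) := by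
  induction l with
  | nil => simp
  | cons b l ih =>
    cases l with
    | nil => simp
    | cons c l =>
      simp only [List.cons_append, pathProd_cons_cons, mul_assoc] at ih ⊢
      rw [ih]

theorem pathProd_append_pair (l : List α) (a b : α) :
    pathProd g (l ++ [a, b]) = pathProd g (l ++ [a]) * g a b := by
  rw [pathProd_append]; simp

theorem map_pathProd {S F : Type*} [Ring S] [FunLike F R S] [RingHomClass F R S] (φ : F)
    (g' : α → α → S) (s : α → α) (h : ∀ i j, φ (g i j) = g' (s i) (s j)) (l : List α) :
    φ (pathProd g l) = pathProd g' (l.map s) := by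
  induction l with
  | nil => simp [pathProd]
  | cons a l ih =>
    cases l with
    | nil => simp
    | cons b l =>
      simp only [pathProd_cons_cons, map_mul, List.map_cons, h] at ih ⊢
      rw [ih]

namespace IsArnold

theorem mul_pathProd (hg : IsArnold g) (x y : α) (l : List α) :
    g x y * pathProd g l = (-1) ^ (l.length - 1) * (pathProd g l * g x y) := by
  induction l with
  | nil => simp [pathProd]
  | cons a l ih =>
    cases l with
    | nil => simp
    | cons b l =>
      simp only [pathProd_cons_cons, List.length_cons, Nat.add_sub_cancel] at ih ⊢
      rw [← mul_assoc, hg.anticomm, neg_mul, mul_assoc, ih, pow_succ, ← mul_assoc (g a b),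
        ((Commute.neg_one_right (g a b)).pow_right _).eq]
      noncomm_ring

theorem mul_pathProd' (hg : IsArnold g) (x y : α) (l : List α) :
    pathProd g l * g x y = (-1) ^ (l.length - 1) * (g x y * pathProd g l) := by
  rw [hg.mul_pathProd, ← mul_assoc, ← pow_add, Even.neg_one_pow ⟨_, rfl⟩, one_mul]

/-- Opening a cycle at a vertex `a`: the three term relation for paths. -/
theorem pathProd_insert (hg : IsArnold g) (a b c : α) (u w : List α) :
    pathProd g (w ++ c :: a :: b :: u) =
      (-1) ^ (w.length + 1) * ((g a b - g a c) * pathProd g (w ++ c :: b :: u)) := by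
  have h : g c a * g a b = -((g a b - g a c) * g c b) := by
    have := hg.mul_common c b a
    rw [hg.symm b a] at this
    rw [hg.symm c a, sub_mul, hg.anticomm a b c b, hg.anticomm a c c b, hg.symm a c, this]
    noncomm_ring
  have hD : pathProd g (w ++ [c]) * (g a b - g a c) =
      (-1) ^ w.length * ((g a b - g a c) * pathProd g (w ++ [c])) := by
    rw [mul_sub, hg.mul_pathProd', hg.mul_pathProd', sub_mul, mul_sub]
    simp
  rw [pathProd_append, pathProd_append w c (b :: u), pathProd_cons_cons, pathProd_cons_cons,
    pathProd_cons_cons, ← mul_assoc (g c a), h, neg_mul, mul_neg, mul_assoc (g a b - g a c),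
    ← mul_assoc (pathProd g (w ++ [c])), hD, pow_succ]
  noncomm_ring

end IsArnold

variable {L : Type*} [Field L] [Algebra L R]

/-- The weighted sum of the paths obtained from a cycle by removing an edge. -/
def cycSum (t : L) (g : α → α → R) (l : List α) : R :=
  ∑ j ∈ range l.length, (t ^ j * (-1) ^ ((l.length - 1) * (j + 1))) • pathProd g (l.rotate (j + 1))

theorem smul_neg_one_pow (k : ℕ) (x : R) : ((-1 : L) ^ k) • x = (-1) ^ k * x := by
  rw [Algebra.smul_def]; simp

/-- In the cycle a :: b the neighbours of a are the head h and the last entry e of b. Deleting a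
from a cut cycle leaves a cut of b, times the difference of the two edges at a. When the cut is next
to a (j = 0 or j = |b|), a is an end of the path and only one of these edges occurs. -/
theorem IsArnold.pathProd_rotate_cons (hg : IsArnold g) (a h e : α) (b : List α) {j : ℕ}
    (hh : b.head? = some h) (he : b.getLast? = some e) (hj : j ≤ b.length) :
    pathProd g ((a :: b).rotate (j + 1)) = (-1 : L) ^ (b.length - j) •
      (((if j = 0 then 0 else g a h) - (if j = b.length then 0 else g a e)) *
        pathProd g (b.rotate j)) := by
  have hb : b ≠ [] := by rintro rfl; simp at hh
  have hlen : 0 < b.length := List.length_pos_iff.2 hb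
  rw [List.rotate_eq_drop_append_take (by simpa using hj), List.rotate_eq_drop_append_take hj,
    smul_neg_one_pow, List.drop_succ_cons, List.take_succ_cons]
  rcases eq_or_ne j 0 with rfl | h0
  · obtain ⟨w, rfl⟩ : ∃ w, b = w ++ [e] := by
      rw [List.getLast?_eq_some_iff] at he; exact he
    have e3 := hg.mul_pathProd a e (w ++ [e])
    rw [if_pos rfl, if_neg (by omega)]
    simp only [List.drop_zero, List.take_zero, List.append_nil, List.append_assoc,
      List.singleton_append, pathProd_append_pair, Nat.sub_zero, zero_sub, neg_mul, e3]
    simp only [List.length_append, List.length_singleton, Nat.add_sub_cancel, pow_succ]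
    rw [mul_neg, mul_neg_one, neg_mul, neg_neg, ← mul_assoc, ← pow_add,
      Even.neg_one_pow ⟨_, rfl⟩, one_mul, hg.symm]
  · rcases eq_or_ne j b.length with rfl | h1
    · obtain ⟨u, rfl⟩ : ∃ u, b = h :: u := by
        rw [List.head?_eq_some_iff] at hh; exact hh
      simp
    · obtain ⟨u, hu⟩ : ∃ u, b.take j = h :: u := by
        rw [← List.head?_eq_some_iff, List.head?_take, if_neg h0, hh]
      obtain ⟨w, hw⟩ : ∃ w, b.drop j = w ++ [e] := by
        rw [← List.getLast?_eq_some_iff, List.getLast?_drop, if_neg (by omega), he]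
      have hwl : b.length - j = w.length + 1 := by
        rw [← List.length_drop, hw]; simp
      rw [hu, hw, if_neg h0, if_neg h1, hwl, List.append_assoc, List.append_assoc,
        List.singleton_append, List.singleton_append, hg.pathProd_insert]

/-- The terms with the edge to h occur for j ≥ 1 and reassemble, after a shift that produces t, to
the cyclic sum of b. The terms with the edge to e reassemble to the sum of the same cycle started at
e. -/
theorem IsArnold.cycSum_cons (hg : IsArnold g) (t : L) (a h e : α) (b : List α)
    (hh : b.head? = some h) (he : b.getLast? = some e) :
    cycSum t g (a :: b) = t • (g a h * cycSum t g b) -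
      (-1 : L) ^ (b.length - 1) • (g a e * cycSum t g (b.rotate (b.length - 1))) := by
  have hb : b ≠ [] := by rintro rfl; simp at hh
  obtain ⟨k, hk⟩ : ∃ k, b.length = k + 1 := Nat.exists_eq_succ_of_ne_zero (by simpa using hb)
  have hr : ∀ j, (b.rotate k).rotate (j + 1) = b.rotate j := by
    intro j
    rw [List.rotate_rotate, show k + (j + 1) = b.length + j by omega, ← List.rotate_rotate,
      List.rotate_length]
  have h0 : cycSum t g (a :: b) = ∑ j ∈ range (k + 2), (t ^ j * (-1) ^ (k * j)) •
      (((if j = 0 then 0 else g a h) - (if j = k + 1 then 0 else g a e)) *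
        pathProd g (b.rotate j)) := by
    unfold cycSum
    rw [List.length_cons, hk]
    refine sum_congr rfl fun j hj => ?_
    have hj' : j ≤ k + 1 := by simpa [Nat.lt_succ_iff] using hj
    rw [hg.pathProd_rotate_cons (L := L) a h e b hh he (hk ▸ hj'), smul_smul, hk, mul_assoc,
      ← pow_add]
    congr 2
    -- The exponents add up to 2(kj + k + 1), so the first two signs together equal (-1)^(kj).
    have : Even ((k + 1 + 1 - 1) * (j + 1) + (k + 1 - j) + k * j) := by
      obtain ⟨i, hi⟩ : ∃ i, k + 1 = j + i := ⟨k + 1 - j, by omega⟩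
      rw [Nat.add_sub_cancel, hi, Nat.add_sub_cancel_left, ← hi]
      exact ⟨k * j + k + 1, by linarith⟩
    rcases Nat.even_or_odd (k * j) with h | h
    · rw [h.neg_one_pow, Even.neg_one_pow ((Nat.even_add.1 this).2 h)]
    · rw [h.neg_one_pow, Odd.neg_one_pow]
      exact Nat.not_even_iff_odd.1 fun h' => Nat.not_even_iff_odd.2 h ((Nat.even_add.1 this).1 h')
  rw [h0, hk, Nat.add_sub_cancel]
  simp only [sub_mul, smul_sub, sum_sub_distrib]
  congr 1
  · rw [sum_range_succ', cycSum, mul_sum, smul_sum, hk]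
    simp only [if_true, zero_mul, smul_zero, add_zero]
    refine sum_congr rfl fun j hj => ?_
    rw [if_neg (by omega), mul_smul_comm, smul_smul, Nat.add_sub_cancel]
    congr 1; ring
  · rw [sum_range_succ, cycSum, mul_sum, smul_sum, List.length_rotate, hk]
    simp only [if_true, zero_mul, smul_zero, add_zero]
    refine sum_congr rfl fun j hj => ?_
    rw [if_neg (by simp at hj; omega), mul_smul_comm, smul_smul, Nat.add_sub_cancel, hr]
    congr 1
    rw [mul_left_comm, ← pow_add, show k + k * (j + 1) = k * j + 2 * k by ring, pow_add,
      pow_mul _ 2 k]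
    simp

end Paths

/-- Modulo U, φ multiplies y by t. Hence y = φ^k y = t^k y modulo U, and t^k - 1 is invertible. -/
theorem mem_of_smul_sub_mem {L V : Type*} [Field L] [AddCommGroup V] [Module L V]
    {U : Submodule L V} {φ : V →ₗ[L] V} (hφ : ∀ u ∈ U, φ u ∈ U) {t : L} {y : V}
    (hy : t • y - φ y ∈ U) {k : ℕ} (hk : (φ ^ k) y = y) (ht : t ^ k ≠ 1) : y ∈ U := by
  have h : ∀ i : ℕ, t ^ i • y - (φ ^ i) y ∈ U := by
    intro i
    induction i with
    | zero => simp
    | succ i ih =>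
      have e : t ^ (i + 1) • y - (φ ^ (i + 1)) y =
          t ^ i • (t • y - φ y) + φ (t ^ i • y - (φ ^ i) y) := by
        rw [pow_succ' φ, Module.End.mul_apply, map_sub, map_smul, smul_sub, smul_smul, pow_succ]
        abel
      rw [e]
      exact U.add_mem (U.smul_mem _ hy) (hφ _ ih)
  have h1 := h k
  rw [hk] at h1
  have h2 : (t ^ k - 1) • y ∈ U := by rwa [sub_smul, one_smul]
  exact (U.smul_mem_iff (sub_ne_zero.2 ht)).1 h2

theorem map_formPerm {α : Type*} [DecidableEq α] (l : List α) (hl : l.Nodup) :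
    l.map l.formPerm = l.rotate 1 := by
  apply List.ext_getElem
  · simp
  · intro i h1 h2
    rw [List.getElem_map, List.formPerm_apply_getElem _ hl, List.getElem_rotate]

theorem map_formPerm_inv {α : Type*} [DecidableEq α] (l : List α) (hl : l.Nodup) :
    l.map (l.formPerm⁻¹ : Equiv.Perm α) = l.rotate (l.length - 1) := by
  rcases Nat.eq_zero_or_pos l.length with h | h
  · rw [List.length_eq_zero_iff.1 h]; simp
  · have h1 : (l.rotate (l.length - 1)).map l.formPerm = l := by
      rw [List.map_rotate, map_formPerm l hl, List.rotate_rotate,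
        show 1 + (l.length - 1) = l.length by omega, List.rotate_length]
    have h2 := congrArg (List.map ⇑(l.formPerm⁻¹ : Equiv.Perm α)) h1
    rw [List.map_map, ← Equiv.Perm.coe_mul, inv_mul_cancel, Equiv.Perm.coe_one, List.map_id] at h2
    exact h2.symm

/-! ### Trees as combinations of paths -/

section Insertion

variable {α R : Type*} [Ring R] {g : α → α → R} {K : Type*} [Field K] [Algebra K R]

/-- The span of the paths through the vertices of `l`, in any order. -/
def pathSpan (K : Type*) [Field K] [Algebra K R] (g : α → α → R) (l : List α) : Submodule K R :=
  Submodule.span K {z | ∃ l', l'.Perm l ∧ z = pathProd g l'}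

theorem neg_one_pow_mul_mem {S : Submodule K R} (k : ℕ) {x : R} (hx : x ∈ S) :
    (-1) ^ k * x ∈ S := by
  rcases neg_one_pow_eq_or R k with h | h <;> rw [h]
  · rwa [one_mul]
  · rw [neg_one_mul]; exact S.neg_mem hx

/-- A leaf b hung on an inner vertex i, with successor c, is either moved on to c or inserted
between i and c, by g_ic g_ib = g_ic g_cb - g_ib g_bc. At the last vertex of the path it simply
prolongs the path. -/
theorem IsArnold.pathProd_mul_mem (hg : IsArnold g) (b : α) (l : List α) (i : α) (w : List α) :
    pathProd g (w ++ i :: l) * g i b ∈ pathSpan K g (b :: (w ++ i :: l)) := by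
  induction l generalizing i w with
  | nil =>
    refine Submodule.subset_span ⟨w ++ [i, b], ?_, (pathProd_append_pair w i b).symm⟩
    rw [List.append_cons w i [b]]
    exact List.perm_append_singleton _ _
  | cons c l ih =>
    have h1 := ih c (w ++ [i])
    rw [List.append_assoc, List.singleton_append] at h1
    have e : pathProd g (w ++ i :: c :: l) * g i b =
        pathProd g (w ++ i :: c :: l) * g c b -
          (-1) ^ l.length * pathProd g (w ++ i :: b :: c :: l) := by
      rw [pathProd_append, pathProd_append w i (b :: c :: l)]
      simp only [pathProd_cons_cons, mul_assoc]
      have cm : ∀ x y : R, y * ((-1) ^ l.length * x) = (-1) ^ l.length * (y * x) := fun x y =>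
        ((Commute.neg_one_left y).pow_left l.length).left_comm x |>.symm
      have h : g i c * g i b = g i c * g c b - g i b * g b c := by
        rw [hg.symm b c, hg.mul_common i c b]
        abel
      rw [hg.mul_pathProd' i b, hg.mul_pathProd' c b, List.length_cons, Nat.add_sub_cancel, cm, cm,
        cm, cm, ← mul_sub, ← mul_sub]
      congr 2
      rw [← mul_assoc, h, sub_mul]
      simp only [mul_assoc]
    rw [e]
    refine Submodule.sub_mem _ h1 (neg_one_pow_mul_mem _ (Submodule.subset_span ⟨_, ?_, rfl⟩))
    rw [List.append_cons w i, List.append_cons w i (c :: l)]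
    exact List.perm_middle

theorem IsArnold.pathSpan_mul_mem (hg : IsArnold g) {l : List α} {i b : α} (hi : i ∈ l) {z : R}
    (hz : z ∈ pathSpan K g l) : z * g i b ∈ pathSpan K g (b :: l) := by
  induction hz using Submodule.span_induction with
  | zero => rw [zero_mul]; exact Submodule.zero_mem _
  | add x y _ _ hx hy => rw [add_mul]; exact Submodule.add_mem _ hx hy
  | smul c x _ hx => rw [smul_mul_assoc]; exact Submodule.smul_mem _ _ hx
  | mem x hx =>
    obtain ⟨l', hl', rfl⟩ := hx
    obtain ⟨w, u, rfl⟩ := List.append_of_mem (hl'.mem_iff.2 hi)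
    have h := hg.pathProd_mul_mem (K := K) b u i w
    refine Submodule.span_mono ?_ h
    rintro _ ⟨m, hm, rfl⟩
    exact ⟨m, hm.trans (hl'.cons b), rfl⟩

theorem pathSpan_perm {l l' : List α} (h : l.Perm l') : pathSpan K g l ≤ pathSpan K g l' := by
  refine Submodule.span_mono ?_
  rintro _ ⟨m, hm, rfl⟩
  exact ⟨m, hm.trans h, rfl⟩

end Insertion

/-! ### The cyclic sum generates all tree monomials -/

section Generation

variable {N : ℕ} {R L : Type*} [Ring R] [Field L] [Algebra L R]
  {g : Fin (N + 1) → Fin (N + 1) → R}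

theorem IsArnold.treeProd_mem_pathSpan (hg : IsArnold g) (f : IncTree N) :
    treeProd g f ∈ pathSpan L g (List.finRange (N + 1)) := by
  -- The first k edges form a tree on the vertices 0, …, k, and the next edge attaches vertex k + 1
  -- as a leaf.
  have key : ∀ k ≤ N, ((List.ofFn fun j => g (f.parent j) j.succ).take k).prod ∈
      pathSpan L g ((List.finRange (N + 1)).take (k + 1)) := by
    intro k hk
    induction k with
    | zero =>
      refine Submodule.subset_span ⟨[0], ?_, by simp⟩
      rw [List.finRange_succ]; simp
    | succ k ih =>
      have hk' : k < N := hk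
      rw [List.take_succ_eq_append_getElem (l := List.ofFn _) (by simpa using hk'),
        List.prod_append, List.prod_singleton, List.getElem_ofFn]
      have h1 := hg.pathSpan_mul_mem (i := f.parent ⟨k, hk'⟩) (b := (⟨k, hk'⟩ : Fin N).succ) ?_
        (ih hk'.le)
      · refine pathSpan_perm ?_ h1
        rw [List.take_succ_eq_append_getElem (i := k + 1) (by simpa using hk'),
          List.getElem_finRange]
        exact (List.perm_append_singleton _ _).symm
      · rw [List.mem_take_iff_getElem]
        have := f.parent_lt ⟨k, hk'⟩
        refine ⟨(f.parent ⟨k, hk'⟩ : ℕ), ?_, ?_⟩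
        · rw [Fin.lt_def] at this
          simp at this ⊢
          omega
        · simp
  have h := key N le_rfl
  rwa [List.take_of_length_le (by simp), List.take_of_length_le (by simp)] at h

theorem IsArnold.mul_pathProd_cons {α : Type*} {g : α → α → R} {X : α → R} (hg : IsArnold g)
    (hX : ∀ i j, X j * g i j = X i * g i j) (a : α) (l : List α) (i : α) (hi : i ∈ a :: l) :
    X i * pathProd g (a :: l) = X a * pathProd g (a :: l) := by
  induction l generalizing a i with
  | nil =>
    rw [List.mem_singleton] at hi
    rw [hi]
  | cons b l ih =>
    rcases List.mem_cons.1 hi with rfl | hi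
    · rfl
    · have h : ∀ c, X c * pathProd g (a :: b :: l) =
          (-1) ^ l.length * (X c * pathProd g (b :: l) * g a b) := by
        intro c
        rw [pathProd_cons_cons, hg.mul_pathProd,
          ← ((Commute.neg_one_left (X c)).pow_left _).left_comm, mul_assoc]
        simp
      rw [h, ih b i hi, ← h, pathProd_cons_cons, ← mul_assoc, hX, mul_assoc]

theorem perm_finRange {n : ℕ} {l : List (Fin n)} (hl : l.Perm (List.finRange n)) :
    ∃ σ : Equiv.Perm (Fin n), l = (List.finRange n).map σ := by
  have hlen : l.length = n := by simpa using hl.length_eq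
  have hnd : l.Nodup := hl.nodup_iff.2 (List.nodup_finRange n)
  have hinj : Function.Injective fun i : Fin n => l.get (i.cast hlen.symm) := by
    intro i j hij
    have := List.nodup_iff_injective_get.1 hnd hij
    simpa using this
  refine ⟨Equiv.ofBijective _ (Finite.injective_iff_bijective.1 hinj), ?_⟩
  apply List.ext_getElem
  · simp [hlen]
  · intro i h1 h2
    simp

/-- A subspace stable under all permutations of the vertices that contains the weighted cyclic sum
of paths contains all tree monomials, if no small power of the weight `t` is `1`. -/
theorem IsArnold.mul_treeProd_mem (hg : IsArnold g) {X : Fin (N + 1) → R}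
    (hX : ∀ i j, X j * g i j = X i * g i j)
    (act : Equiv.Perm (Fin (N + 1)) →* (R →ₐ[L] R))
    (act_g : ∀ σ i j, act σ (g i j) = g (σ i) (σ j)) (act_X : ∀ σ i, act σ (X i) = X (σ i))
    {U : Submodule L R} (hU : ∀ σ, ∀ u ∈ U, act σ u ∈ U) {t : L}
    (ht : ∀ k, 0 < k → k < N + 1 → t ^ k ≠ 1)
    (h : X 0 * cycSum t g (List.finRange (N + 1)) ∈ U) (f : IncTree N) :
    X 0 * treeProd g f ∈ U := by
  have act_path : ∀ σ l, act σ (pathProd g l) = pathProd g (l.map σ) := fun σ l =>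
    map_pathProd (act σ) g σ (act_g σ) l
  have act_cyc : ∀ σ l, act σ (cycSum t g l) = cycSum t g (l.map σ) := by
    intro σ l
    simp [cycSum, act_path, List.map_rotate]
  -- The vertices move one by one from the cycle a :: b to the path w ++ [a]. Vertex 0 stays at the
  -- start of the path, so the permutations used below fix the label X 0.
  have key : ∀ (b w : List (Fin (N + 1))) (a : Fin (N + 1)), (w ++ a :: b).Nodup →
      (w ++ a :: b).head? = some 0 → X 0 * pathProd g (w ++ [a]) * cycSum t g (a :: b) ∈ U →
      X 0 * pathProd g (w ++ a :: b) ∈ U := by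
    intro b
    induction b with
    | nil =>
      intro w a _ _ h
      simpa [cycSum] using h
    | cons c b ih =>
      intro w a hnd h0 h
      have hcb : (c :: b).Nodup := (List.nodup_append.1 hnd).2.1.of_cons
      obtain ⟨e, he⟩ : ∃ e, (c :: b).getLast? = some e := ⟨_, List.getLast?_cons⟩
      -- This inverse cycle fixes the path already built, sends c to e and turns c :: b into the
      -- rotation starting at e: it carries the first term of `cycSum_cons` to the second, up to
      -- scalars.
      set z : Equiv.Perm (Fin (N + 1)) := (c :: b).formPerm⁻¹ with hz
      have hlen : (c :: b).length < N + 1 := by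
        have := hnd.length_le_card
        simp at this ⊢
        omega
      have hfix : ∀ i ∈ w ++ [a], z i = i := by
        intro i hi
        rw [hz, Equiv.Perm.inv_eq_iff_eq, List.formPerm_apply_of_notMem]
        rw [List.append_cons, List.nodup_append] at hnd
        exact fun hi' => hnd.2.2 i hi i hi' rfl
      have hz0 : z 0 = 0 := by
        apply hfix
        rw [List.append_cons, List.head?_append_of_ne_nil _ (by simp)] at h0
        exact List.mem_of_mem_head? h0
      have hzw : (w ++ [a]).map z = w ++ [a] := by
        conv_rhs => rw [← List.map_id (w ++ [a])]
        exact List.map_congr_left hfix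
      have hzc : z c = e := by
        have h1 := map_formPerm_inv _ hcb
        have h2 := congrArg List.head? h1
        rw [List.head?_rotate (by simp), ← List.getLast?_eq_getElem?, he] at h2
        rw [List.map_cons, List.head?_cons] at h2
        exact Option.some_injective _ h2
      have hind := ih (w ++ [a]) c
      simp only [List.append_assoc, List.singleton_append] at hind
      refine hind hnd h0 ?_
      set y := X 0 * pathProd g (w ++ [a, c]) * cycSum t g (c :: b) with hy
      have hay : act z y = X 0 * pathProd g (w ++ [a]) *
          (g a e * cycSum t g ((c :: b).rotate ((c :: b).length - 1))) := by
        rw [hy, pathProd_append_pair, map_mul, map_mul, map_mul, act_X, act_path, act_g, act_cyc,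
          hzw, hz0, hzc, hfix a (by simp), hz, map_formPerm_inv _ hcb]
        simp only [mul_assoc]
      have hsub : X 0 * pathProd g (w ++ [a]) * cycSum t g (a :: c :: b) =
          t • y - ((-1 : L) ^ ((c :: b).length - 1) • (act z).toLinearMap) y := by
        rw [hg.cycSum_cons t a c e (c :: b) rfl he, LinearMap.smul_apply, AlgHom.toLinearMap_apply,
          hay, hy, mul_sub, mul_smul_comm, mul_smul_comm, pathProd_append_pair]
        simp only [mul_assoc]
      rw [hsub] at h
      -- With k the length of c :: b, the permutation has z^k = 1 and the sign contributes
      -- (-1)^((k-1)k) = 1. As a lies outside the cycle, k < N + 1 and t^k ≠ 1.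
      refine mem_of_smul_sub_mem (k := (c :: b).length) ?_ h ?_ (ht _ (by simp) hlen)
      · intro u hu
        exact U.smul_mem _ (hU z u hu)
      · have hzk : z ^ (c :: b).length = 1 := by
          rw [hz, inv_pow, List.formPerm_pow_length_eq_one_of_nodup _ hcb, inv_one]
        have hpow : ∀ k : ℕ, (act z).toLinearMap ^ k = (act (z ^ k)).toLinearMap := by
          intro k
          induction k with
          | zero => rw [pow_zero, pow_zero, map_one]; rfl
          | succ k ih => rw [pow_succ, ih, pow_succ, map_mul]; rfl
        rw [smul_pow, hpow, hzk, map_one, ← pow_mul, mul_comm, Even.neg_one_pow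
          (by simpa [Nat.add_sub_cancel] using Nat.even_mul_pred_self (c :: b).length), one_smul]
        rfl
  have hpath : ∀ σ : Equiv.Perm (Fin (N + 1)),
      X 0 * pathProd g ((List.finRange (N + 1)).map σ) ∈ U := by
    intro σ
    have h1 : X 0 * pathProd g (List.finRange (N + 1)) ∈ U := by
      have h2 := key ((List.finRange N).map Fin.succ) [] 0
      simp only [List.nil_append, ← List.finRange_succ] at h2
      refine h2 (List.nodup_finRange _) (by rw [List.finRange_succ]; rfl) (by simpa using h)
    have h2 := hU σ _ h1
    rw [map_mul, act_X, act_path] at h2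
    -- The permutation moves the label to σ 0; it slides back to 0 along the path, which visits
    -- every vertex.
    have h3 : ∀ i, X i * pathProd g ((List.finRange (N + 1)).map σ) =
        X (σ 0) * pathProd g ((List.finRange (N + 1)).map σ) := by
      intro i
      have := hg.mul_pathProd_cons hX (σ 0) (((List.finRange N).map Fin.succ).map σ) i
      rw [← List.map_cons, ← List.finRange_succ] at this
      refine this ?_
      rw [List.mem_map]
      exact ⟨σ⁻¹ i, List.mem_finRange _, by simp⟩
    rwa [h3 0]
  have hle : pathSpan L g (List.finRange (N + 1)) ≤ U.comap (LinearMap.mulLeft L (X 0)) := by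
    rw [pathSpan, Submodule.span_le]
    rintro _ ⟨l, hl, rfl⟩
    obtain ⟨σ, rfl⟩ := perm_finRange hl
    exact hpath σ
  exact hle (hg.treeProd_mem_pathSpan f)

end Generation

/-! ### A module over the Arnold algebra with independent tree monomials -/

namespace ArnoldModule

variable {K M ι : Type*} [Field K] [AddCommGroup M] [Module K M]

variable (K) in
/-- The inclusion of the classes without edge at the new vertex. -/
def base (ι : Type*) : M →ₗ[K] M × (ι → M) := LinearMap.inl K M (ι → M)

/-- The extension of an operator to the classes with a new vertex. -/
def lift (φ : Module.End K M) : Module.End K (M × (ι → M)) := φ.prodMap (φ.compLeft ι)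

/-- The extension of the parity operator. -/
def newParity (s : Module.End K M) : Module.End K (M × (ι → M)) := s.prodMap (-s.compLeft ι)

@[simp] theorem lift_base (φ : Module.End K M) (m : M) :
    lift φ (base K ι m) = base K ι (φ m) := by
  ext <;> simp [lift, base]

@[simp] theorem newParity_base (φ : Module.End K M) (m : M) :
    newParity φ (base K ι m) = base K ι (φ m) := by
  ext <;> simp [newParity, base]

variable [DecidableEq ι]

variable (K) in
/-- The inclusion of the classes with an edge joining the new vertex to `l`. -/
def edge (l : ι) : M →ₗ[K] M × (ι → M) :=
  LinearMap.inr K M (ι → M) ∘ₗ LinearMap.single K (fun _ => M) l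

@[simp] theorem lift_edge (φ : Module.End K M) (l : ι) (m : M) :
    lift φ (edge K l m) = edge K l (φ m) := by
  ext i
  · simp [lift, edge]
  · by_cases h : i = l
    · subst h; simp [lift, edge]
    · simp [lift, edge, h]

@[simp] theorem newParity_edge (φ : Module.End K M) (l : ι) (m : M) :
    newParity φ (edge K l m) = -edge K l (φ m) := by
  ext i
  · simp [newParity, edge]
  · by_cases h : i = l
    · subst h; simp [newParity, edge]
    · simp [newParity, edge, h]

variable [Fintype ι]

theorem hom_ext {φ ψ : Module.End K (M × (ι → M))} (h1 : ∀ m, φ (base K ι m) = ψ (base K ι m))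
    (h2 : ∀ l m, φ (edge K l m) = ψ (edge K l m)) : φ = ψ := by
  refine LinearMap.prod_ext (LinearMap.ext h1) (LinearMap.pi_ext' fun l => LinearMap.ext (h2 l))

/-- The operator of the generator joining `j` to the new vertex. -/
def newEdge (e : ι → ι → Module.End K M) (s : Module.End K M) (j : ι) :
    Module.End K (M × (ι → M)) :=
  -- With `edge l m` read as m G_l, where G_l joins l to the new vertex, G_j m = s(m) G_j gives the
  -- first part. The relation G_j G_l = G_jl (G_l - G_j) gives the second, the sign of s being
  -- absorbed when G_jl moves back past m.
  (edge K j ∘ₗ s).coprod (LinearMap.lsum K (fun _ => M) K fun l => (edge K l - edge K j) ∘ₗ e j l)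

@[simp] theorem newEdge_base (e : ι → ι → Module.End K M) (s : Module.End K M) (j : ι) (m : M) :
    newEdge e s j (base K ι m) = edge K j (s m) := by
  simp [newEdge, base]

@[simp] theorem newEdge_edge (e : ι → ι → Module.End K M) (s : Module.End K M) (j l : ι) (m : M) :
    newEdge e s j (edge K l m) = edge K l (e j l m) - edge K j (e j l m) := by
  have h : ∀ φ : ι → (M →ₗ[K] M × (ι → M)),
      LinearMap.lsum K (fun _ => M) K φ (Pi.single l m) = φ l m := by
    intro φ
    rw [LinearMap.lsum_apply, LinearMap.sum_apply, Finset.sum_eq_single l]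
    · simp
    · intro b _ hb
      simp [hb]
    · simp
  change edge K j (s 0) + LinearMap.lsum K (fun _ => M) K _ (Pi.single l m) = _
  rw [h]
  simp

variable {e : ι → ι → Module.End K M} {s : Module.End K M}

theorem newEdge_anticomm (he : IsArnold e) (j k : ι) :
    newEdge e s j * newEdge e s k = -(newEdge e s k * newEdge e s j) := by
  have ha : ∀ i j k l m, e i j (e k l m) = -e k l (e i j m) := fun i j k l m =>
    LinearMap.congr_fun (he.anticomm i j k l) m
  have hc : ∀ i j k m, e i j (e j k m) + e j k (e k i m) + e k i (e i j m) = 0 :=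
    fun i j k m => LinearMap.congr_fun (he.cyclic i j k) m
  refine hom_ext (fun m => ?_) (fun l m => ?_)
  · simp [he.symm k j]
  · simp only [Module.End.mul_apply, newEdge_edge, map_sub, LinearMap.neg_apply]
    have h1 : e k j (e j l m) = e j k (e k l m) + e k l (e j l m) := by
      have h := hc j k l m
      rw [he.symm l j, ha j l j k, he.symm j k, ← sub_eq_add_neg, sub_eq_zero] at h
      rw [← h, he.symm k j]
    rw [h1, ha j l k l]
    simp only [map_add, map_neg]
    abel

theorem newEdge_lift (he : IsArnold e) (hs : ∀ i j, s * e i j = -(e i j * s)) (j k l : ι) :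
    newEdge e s j * lift (e k l) = -(lift (e k l) * newEdge e s j) := by
  have ha : ∀ i j k l m, e i j (e k l m) = -e k l (e i j m) := fun i j k l m =>
    LinearMap.congr_fun (he.anticomm i j k l) m
  have hs' : ∀ i j m, s (e i j m) = -e i j (s m) := fun i j m => LinearMap.congr_fun (hs i j) m
  refine hom_ext (fun m => ?_) (fun i m => ?_)
  · simp [hs']
  · simp [ha j i k l]
    abel

theorem newEdge_cyclic (he : IsArnold e) (hs : ∀ i j, s * e i j = -(e i j * s)) (i j : ι) :
    lift (e i j) * newEdge e s j + newEdge e s j * newEdge e s i +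
      newEdge e s i * lift (e i j) = 0 := by
  have ha : ∀ i j k l m, e i j (e k l m) = -e k l (e i j m) := fun i j k l m =>
    LinearMap.congr_fun (he.anticomm i j k l) m
  have hc : ∀ i j k m, e i j (e j k m) + e j k (e k i m) + e k i (e i j m) = 0 :=
    fun i j k m => LinearMap.congr_fun (he.cyclic i j k) m
  have hs' : ∀ i j m, s (e i j m) = -e i j (s m) := fun i j m => LinearMap.congr_fun (hs i j) m
  refine hom_ext (fun m => ?_) (fun l m => ?_)
  · simp [hs', he.symm j i]
  · simp
    have h1 := hc i j l m
    rw [he.symm l i] at h1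
    rw [add_assoc] at h1
    have h2 : e j i (e i l m) = -e i l (e i j m) := by rw [ha, he.symm j i]
    rw [eq_neg_of_add_eq_zero_left h1, h2]
    simp only [map_add, map_neg]
    abel

end ArnoldModule

section Extend

variable {A : Type*} [Ring A] {n : ℕ}

/-- The extension of a system of generators by the generators of a new last vertex. -/
def extend (e : Fin n → Fin n → A) (N : Fin n → A) (i j : Fin (n + 1)) : A :=
  Fin.lastCases (motive := fun _ => A) (Fin.lastCases (motive := fun _ => A) 0 N j)
    (fun i => Fin.lastCases (motive := fun _ => A) (N i) (e i) j) i

variable {e : Fin n → Fin n → A} {N : Fin n → A}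

@[simp] theorem extend_last_last : extend e N (Fin.last n) (Fin.last n) = 0 := by simp [extend]

@[simp] theorem extend_last_castSucc (j : Fin n) :
    extend e N (Fin.last n) j.castSucc = N j := by simp [extend]

@[simp] theorem extend_castSucc_last (j : Fin n) :
    extend e N j.castSucc (Fin.last n) = N j := by simp [extend]

@[simp] theorem extend_castSucc_castSucc (i j : Fin n) :
    extend e N i.castSucc j.castSucc = e i j := by simp [extend]

theorem IsArnold.extend (he : IsArnold e) (hN : ∀ j k, N j * N k = -(N k * N j))
    (hNe : ∀ j k l, N j * e k l = -(e k l * N j))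
    (hcyc : ∀ i j, e i j * N j + N j * N i + N i * e i j = 0) : IsArnold (extend e N) := by
  have sq : ∀ j, N j * N j = 0 := fun j => by simpa [he.diag] using hcyc j j
  have heN : ∀ j k l, e k l * N j = -(N j * e k l) := fun j k l => by rw [hNe, neg_neg]
  refine ⟨fun i j => ?_, fun i => ?_, fun i j k l => ?_, fun i j k => ?_⟩
  · refine Fin.lastCases ?_ (fun i => ?_) i <;> refine Fin.lastCases ?_ (fun j => ?_) j <;> simp
    exact he.symm _ _
  · refine Fin.lastCases ?_ (fun i => ?_) i <;> simp [he.diag]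
  · refine Fin.lastCases ?_ (fun i => ?_) i <;> refine Fin.lastCases ?_ (fun j => ?_) j <;>
      refine Fin.lastCases ?_ (fun k => ?_) k <;> refine Fin.lastCases ?_ (fun l => ?_) l <;>
      simp
    all_goals first
      | exact hN _ _
      | exact hNe _ _ _
      | exact heN _ _ _
      | exact he.anticomm _ _ _ _
  · refine Fin.lastCases ?_ (fun i => ?_) i <;> refine Fin.lastCases ?_ (fun j => ?_) j <;>
      refine Fin.lastCases ?_ (fun k => ?_) k <;> simp [sq]
    all_goals first
      | exact hcyc _ _
      | exact he.cyclic _ _ _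
      | (rw [add_assoc, add_comm]; exact hcyc _ _)
      | (rw [add_comm, ← add_assoc]; exact hcyc _ _)

end Extend

section Existence

open ArnoldModule

/-- A module over the Arnold algebra on the vertices `0, …, N`, with a parity operator `s`, and an
even vector `v` on which the tree monomials are linearly independent. -/
theorem exists_arnoldModule (K : Type u) [Field K] (N : ℕ) :
    ∃ (M : Type u) (_ : AddCommGroup M) (_ : Module K M)
      (e : Fin (N + 1) → Fin (N + 1) → Module.End K M) (s : Module.End K M) (v : M),
      IsArnold e ∧ (∀ i j, s * e i j = -(e i j * s)) ∧ s v = v ∧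
        LinearIndependent K fun f : IncTree N => treeProd e f v := by
  induction N with
  | zero =>
    refine ⟨K, inferInstance, inferInstance, fun _ _ => 0, 1, 1, ⟨?_, ?_, ?_, ?_⟩, ?_, rfl, ?_⟩
    all_goals try simp
    simp [treeProd]
  | succ N ih =>
    obtain ⟨M, _, _, e, s, v, he, hs, hv, hli⟩ := ih
    set e' : Fin (N + 2) → Fin (N + 2) → Module.End K (M × (Fin (N + 1) → M)) :=
      extend (fun i j => lift (e i j)) (newEdge e s) with he'_def
    have lift_mul : ∀ a b : Module.End K M,
        (lift a * lift b : Module.End K (M × (Fin (N + 1) → M))) = lift (a * b) :=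
      fun a b => hom_ext (by simp) (by simp)
    have lift_neg : ∀ a : Module.End K M,
        (lift (-a) : Module.End K (M × (Fin (N + 1) → M))) = -lift a :=
      fun a => hom_ext (by simp) (by simp)
    have lift_add : ∀ a b : Module.End K M,
        (lift (a + b) : Module.End K (M × (Fin (N + 1) → M))) = lift a + lift b :=
      fun a b => hom_ext (by simp) (by simp)
    have lift_zero : (lift 0 : Module.End K (M × (Fin (N + 1) → M))) = 0 :=
      hom_ext (by simp) (by simp)
    have hlift : IsArnold fun i j => (lift (e i j) : Module.End K (M × (Fin (N + 1) → M))) := by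
      refine ⟨fun i j => ?_, fun i => ?_, fun i j k l => ?_, fun i j k => ?_⟩
      · rw [he.symm]
      · rw [he.diag, lift_zero]
      · rw [lift_mul, lift_mul, he.anticomm, lift_neg]
      · rw [lift_mul, lift_mul, lift_mul, ← lift_add, ← lift_add, he.cyclic, lift_zero]
    have he' : IsArnold e' :=
      hlift.extend (newEdge_anticomm he) (newEdge_lift he hs) (newEdge_cyclic he hs)
    refine ⟨M × (Fin (N + 1) → M), Prod.instAddCommGroup, Prod.instModule, e', newParity s,
      base K _ v, he', fun i j => ?_, by simp [hv], ?_⟩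
    · have hs' : ∀ i j m, s (e i j m) = -e i j (s m) := fun i j m => LinearMap.congr_fun (hs i j) m
      refine Fin.lastCases ?_ (fun i => ?_) i <;> refine Fin.lastCases ?_ (fun j => ?_) j <;>
        simp only [he'_def, extend_last_last, extend_last_castSucc, extend_castSucc_last,
          extend_castSucc_castSucc, zero_mul, mul_zero, neg_zero] <;>
        refine hom_ext ?_ ?_ <;> simp [hs', sub_eq_add_neg]
    -- The edge at the newest vertex is the rightmost factor, so it acts first and selects the
    -- summand of its parent. The other edges act inside that summand, where independence is known
    -- by induction.
    · have hprod : ∀ f : IncTree (N + 1), treeProd e' f (base K _ v) =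
          edge K (f (Fin.last N)) (treeProd e (fun j => f j.castSucc) v) := by
        intro f
        have hlist : ∀ (l : List (Module.End K M)) (i : Fin (N + 1)) (w : M),
            (l.map lift).prod (edge K i w) = edge K i (l.prod w) := by
          intro l i w
          induction l with
          | nil => simp
          | cons a l ih => simp [ih]
        have h1 : treeProd e' f = ((List.ofFn fun j : Fin N =>
            e (IncTree.parent (fun j => f j.castSucc) j) j.succ).map lift).prod *
            newEdge e s (f (Fin.last N)) := by
          unfold treeProd
          rw [List.ofFn_succ', List.concat_eq_append, List.prod_append, List.prod_singleton,
            List.map_ofFn]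
          congr 1
          · congr 2
            funext j
            exact extend_castSucc_castSucc (e := fun i j => lift (e i j)) (N := newEdge e s)
              (IncTree.parent (fun j => f j.castSucc) j) j.succ
          · exact extend_castSucc_last (e := fun i j => lift (e i j)) (N := newEdge e s) _
        rw [h1, Module.End.mul_apply, newEdge_base, hv, hlist]
        rfl
      have hsingle : LinearIndependent K fun p : (_ : Fin (N + 1)) × IncTree N =>
          (Pi.single p.1 (treeProd e p.2 v) : Fin (N + 1) → M) :=
        Pi.linearIndependent_single (fun _ f => treeProd e f v) fun _ => hli
      have hinr : LinearIndependent K fun p : (_ : Fin (N + 1)) × IncTree N =>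
          edge K p.1 (treeProd e p.2 v) :=
        hsingle.map' (LinearMap.inr K M (Fin (N + 1) → M))
          (LinearMap.ker_eq_bot.2 LinearMap.inr_injective)
      have hinj : Function.Injective fun f : IncTree (N + 1) =>
          (⟨f (Fin.last N), fun j => f j.castSucc⟩ : (_ : Fin (N + 1)) × IncTree N) := by
        intro f f' h
        simp only [Sigma.mk.injEq, heq_eq_eq] at h
        funext j
        refine Fin.lastCases ?_ (fun j => ?_) j
        · exact h.1
        · exact congrFun h.2 j
      have := hinr.comp _ hinj
      rw [show (fun f => treeProd e' f (base K _ v)) = _ from funext hprod]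
      exact this

end Existence

/-! ### The parity operator on H -/

section Parity

variable {K : Type*} [Field K] {H : Type*} [Ring H] [Algebra K H]
  (𝓗 : ℕ → Submodule K H) [GradedAlgebra 𝓗]

/-- The parity operator of a graded algebra: `x ↦ (-1)^|x| x`. -/
def parity : H →ₗ[K] H :=
  (DirectSum.toModule K ℕ H fun a => (-1 : K) ^ a • (𝓗 a).subtype) ∘ₗ
    (DirectSum.decomposeLinearEquiv 𝓗).toLinearMap

variable {𝓗}

theorem parity_of_mem {a : ℕ} {x : H} (hx : x ∈ 𝓗 a) : parity 𝓗 x = (-1 : K) ^ a • x := by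
  rw [parity, LinearMap.comp_apply]
  change DirectSum.toModule K ℕ H _ (DirectSum.decompose 𝓗 x) = _
  rw [DirectSum.decompose_of_mem 𝓗 hx]
  erw [DirectSum.toModule_lof]
  rfl

theorem parity_one : parity 𝓗 (1 : H) = 1 := by
  rw [parity_of_mem (SetLike.GradedOne.one_mem (A := 𝓗)), pow_zero, one_smul]

theorem parity_mul {a : ℕ} {x : H} (hx : x ∈ 𝓗 a) (y : H) :
    parity 𝓗 (x * y) = (-1 : K) ^ a • (x * parity 𝓗 y) := by
  induction y using DirectSum.Decomposition.inductionOn 𝓗 with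
  | zero => simp
  | homogeneous y =>
    rw [parity_of_mem (SetLike.GradedMul.mul_mem hx y.2), parity_of_mem y.2, pow_add,
      mul_smul_comm, smul_smul]
  | add y z hy hz => rw [mul_add, map_add, hy, hz, map_add, mul_add, smul_add]

theorem parity_parity (x : H) : parity 𝓗 (parity 𝓗 x) = x := by
  induction x using DirectSum.Decomposition.inductionOn 𝓗 with
  | zero => simp
  | homogeneous y =>
    rw [parity_of_mem y.2, map_smul, parity_of_mem y.2, smul_smul, ← pow_add,
      Even.neg_one_pow ⟨_, rfl⟩, one_smul]
  | add y z hy hz => rw [map_add, map_add, hy, hz]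

end Parity

/-! ### The generators of the model form an Arnold system -/

section Generators

variable {K : Type*} [Field K] {H : Type*} [Ring H] [Algebra K H]
  (𝓗 : ℕ → Submodule K H) {n : ℕ}

/-- The exterior generators of the Kriz model, extended by zero to the diagonal. -/
def gen (i j : Fin n) : Model 𝓗 n := if h : i ≠ j then G 𝓗 i j h else 0

theorem gen_of_ne {i j : Fin n} (h : i ≠ j) : gen 𝓗 i j = G 𝓗 i j h := dif_pos h

theorem gen_self (i : Fin n) : gen 𝓗 i i = 0 := dif_neg (by simp)

/-- The presentation gives only anticommutation, so G_ij² = 0 uses that 2 is invertible. The three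
term relation with coinciding indices reduces to these squares. -/
theorem isArnold_gen [CharZero K] : IsArnold (gen 𝓗 (n := n)) := by
  have anti : ∀ i j k l : Fin n, gen 𝓗 i j * gen 𝓗 k l = -(gen 𝓗 k l * gen 𝓗 i j) := by
    intro i j k l
    by_cases hij : i = j
    · rw [hij, gen_self]; simp
    by_cases hkl : k = l
    · rw [hkl, gen_self]; simp
    rw [gen_of_ne 𝓗 hij, gen_of_ne 𝓗 hkl, G_G]
  have symm : ∀ i j : Fin n, gen 𝓗 i j = gen 𝓗 j i := by
    intro i j
    by_cases hij : i = j
    · rw [hij]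
    rw [gen_of_ne 𝓗 hij, gen_of_ne 𝓗 (Ne.symm hij), G_symm]
  have sq : ∀ i j : Fin n, gen 𝓗 i j * gen 𝓗 i j = 0 := by
    intro i j
    have h := anti i j i j
    rw [eq_neg_iff_add_eq_zero, ← two_smul K] at h
    exact (smul_eq_zero.1 h).resolve_left two_ne_zero
  refine ⟨symm, gen_self 𝓗, anti, fun i j k => ?_⟩
  by_cases hij : i = j
  · subst hij
    rw [gen_self, zero_mul, mul_zero, zero_add, add_zero, symm k i, sq]
  by_cases hjk : j = k
  · subst hjk
    rw [gen_self, zero_mul, mul_zero, zero_add, zero_add, symm j i, sq]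
  by_cases hik : i = k
  · subst hik
    rw [gen_self, zero_mul, mul_zero, add_zero, add_zero, symm j i, sq]
  have h := arnold 𝓗 i j k hij hjk hik
  rw [← gen_of_ne, ← gen_of_ne, ← gen_of_ne] at h
  rw [symm k i, anti j k i k, anti i k i j, h]
  abel

theorem p_gen (x : H) (i j : Fin n) :
    p 𝓗 j x * gen 𝓗 i j = p 𝓗 i x * gen 𝓗 i j := by
  by_cases hij : i = j
  · rw [hij]
  · rw [gen_of_ne 𝓗 hij, p_G]

theorem permHom_gen (σ : Equiv.Perm (Fin n)) (i j : Fin n) :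
    permHom 𝓗 σ (gen 𝓗 i j) = gen 𝓗 (σ i) (σ j) := by
  by_cases hij : i = j
  · rw [hij, gen_self, gen_self, map_zero]
  · rw [gen_of_ne 𝓗 hij, gen_of_ne 𝓗 (σ.injective.ne hij), permHom_G]

theorem p_mul (i : Fin n) (x y : H) : p 𝓗 i (x * y) = p 𝓗 i x * p 𝓗 i y := by
  simpa [p] using mk_rel 𝓗 (.p_mul i x y)

/-- The map `p_i^*` as a linear map. -/
def pLinear (i : Fin n) : H →ₗ[K] Model 𝓗 n where
  toFun := p 𝓗 i
  map_add' x y := by simpa [p] using mk_rel 𝓗 (.p_add i x y)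
  map_smul' c x := by simpa [p] using mk_rel 𝓗 (.p_smul i c x)

@[simp] theorem pLinear_apply (i : Fin n) (x : H) : pLinear 𝓗 i x = p 𝓗 i x := rfl

theorem p_one (i : Fin n) : p 𝓗 i (1 : H) = 1 := by
  simpa [p] using mk_rel 𝓗 (.p_one i)

end Generators

/-! ### Independence of the marked tree monomials -/

section Independence

variable {K : Type u} [Field K] {H : Type*} [Ring H] [Algebra K H]
  {𝓗 : ℕ → Submodule K H} [GradedAlgebra 𝓗] {n : ℕ}
  {M : Type*} [AddCommGroup M] [Module K M]

variable (M) in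
/-- The operator of left multiplication by `x` on `H ⊗ M`. -/
def pOp (x : H) : Module.End K (H ⊗[K] M) :=
  TensorProduct.map (LinearMap.mulLeft K x) LinearMap.id

variable (𝓗) in
/-- The odd operator on `H ⊗ M` given by an odd operator on `M`. -/
def oddOp (φ : Module.End K M) : Module.End K (H ⊗[K] M) := TensorProduct.map (parity 𝓗) φ

@[simp] theorem pOp_tmul (x z : H) (m : M) : pOp (K := K) M x (z ⊗ₜ m) = (x * z) ⊗ₜ m := rfl

@[simp] theorem oddOp_tmul (φ : Module.End K M) (z : H) (m : M) :
    oddOp 𝓗 φ (z ⊗ₜ m) = parity 𝓗 z ⊗ₜ φ m := rfl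

theorem op_ext {φ ψ : Module.End K (H ⊗[K] M)} (h : ∀ z m, φ (z ⊗ₜ m) = ψ (z ⊗ₜ m)) : φ = ψ :=
  TensorProduct.ext' h

theorem pOp_add (x y : H) : pOp (K := K) M (x + y) = pOp M x + pOp M y :=
  op_ext fun z m => by simp [add_mul, TensorProduct.add_tmul]

theorem pOp_smul (c : K) (x : H) : pOp (K := K) M (c • x) = c • pOp M x :=
  op_ext fun z m => by simp [TensorProduct.smul_tmul']

theorem pOp_one : pOp (K := K) M (1 : H) = 1 :=
  op_ext fun z m => by simp

theorem pOp_mul (x y : H) : pOp (K := K) M (x * y) = pOp M x * pOp M y :=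
  op_ext fun z m => by simp [mul_assoc]

theorem oddOp_mul_pOp {a : ℕ} {x : H} (hx : x ∈ 𝓗 a) (φ : Module.End K M) :
    oddOp 𝓗 φ * pOp M x = (-1 : K) ^ a • (pOp M x * oddOp 𝓗 φ) :=
  op_ext fun z m => by simp [parity_mul hx, TensorProduct.smul_tmul']

theorem oddOp_mul_oddOp (φ ψ : Module.End K M) :
    oddOp 𝓗 φ * oddOp 𝓗 ψ = TensorProduct.map LinearMap.id (φ * ψ) :=
  op_ext fun z m => by simp [parity_parity]

/-- All p_i act by the same left multiplication on H, so sliding labels is automatic and p_comm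
becomes graded commutativity of H. The parity on the factor H supplies the sign for moving G_ij past
a label. -/
theorem rel_free_action (hcomm : GradedCommutative K 𝓗) {e : Fin n → Fin n → Module.End K M}
    (he : IsArnold e) {F : FreeAlgebra K (Gen H n) →ₐ[K] Module.End K (H ⊗[K] M)}
    (hp : ∀ i x, F (fp K n i x) = pOp M x) (hG : ∀ i j hij, F (fG K H i j hij) = oddOp 𝓗 (e i j))
    {a b : FreeAlgebra K (Gen H n)} (h : Rel 𝓗 n a b) : F a = F b := by
  cases h with
  | p_add i x y => rw [map_add, hp, hp, hp, pOp_add]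
  | p_smul i c x => rw [map_smul, hp, hp, pOp_smul]
  | p_one i => rw [hp, map_one, pOp_one]
  | p_mul i x y => rw [map_mul, hp, hp, hp, pOp_mul]
  | p_comm i j hij a b x y hx hy =>
    rw [map_smul, map_mul, map_mul, hp, hp, ← pOp_mul, ← pOp_mul, ← pOp_smul,
      hcomm a b x y hx hy]
  | G_p i j hij l a x hx => rw [map_smul, map_mul, map_mul, hp, hG, oddOp_mul_pOp hx]
  | G_G i j hij k l hkl =>
    rw [map_neg, map_mul, map_mul, hG, hG, oddOp_mul_oddOp, oddOp_mul_oddOp, he.anticomm]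
    exact op_ext fun z m => by simp [TensorProduct.tmul_neg]
  | G_symm i j hij => rw [hG, hG, he.symm]
  | p_G i j hij x => rw [map_mul, map_mul, hp, hp]
  | arnold i j k hij hjk =>
    rw [map_sub, map_mul, map_mul, map_mul, hG, hG, hG, oddOp_mul_oddOp, oddOp_mul_oddOp,
      oddOp_mul_oddOp, he.mul_common]
    exact op_ext fun z m => by simp [TensorProduct.tmul_sub]

/-- The action of the Kriz model on `H ⊗ M`, for a module `M` over the Arnold algebra. -/
theorem exists_action (hcomm : GradedCommutative K 𝓗) {e : Fin n → Fin n → Module.End K M}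
    (he : IsArnold e) : ∃ F : Model 𝓗 n →ₐ[K] Module.End K (H ⊗[K] M),
      (∀ i x, F (p 𝓗 i x) = pOp M x) ∧ ∀ i j, F (gen 𝓗 i j) = oddOp 𝓗 (e i j) := by
  let F₀ : FreeAlgebra K (Gen H n) →ₐ[K] Module.End K (H ⊗[K] M) :=
    FreeAlgebra.lift K fun g => match g with
      | .p _ x => pOp M x
      | .G i j _ => oddOp 𝓗 (e i j)
  have hp : ∀ i x, F₀ (fp K n i x) = pOp M x := fun i x => FreeAlgebra.lift_ι_apply _ _
  have hG : ∀ i j hij, F₀ (fG K H i j hij) = oddOp 𝓗 (e i j) := fun i j hij =>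
    FreeAlgebra.lift_ι_apply _ _
  refine ⟨RingQuot.liftAlgHom K ⟨F₀, fun a b h => rel_free_action hcomm he hp hG h⟩,
    fun i x => ?_, fun i j => ?_⟩
  · rw [p, RingQuot.liftAlgHom_mkAlgHom_apply, hp]
  · by_cases hij : i = j
    · rw [hij, gen_self, he.diag, map_zero, oddOp, TensorProduct.map_zero_right]
    · rw [gen_of_ne 𝓗 hij, G, RingQuot.liftAlgHom_mkAlgHom_apply, hG]

theorem list_map_oddOp_prod (l : List (Module.End K M)) (w : M) :
    (l.map (oddOp 𝓗)).prod ((1 : H) ⊗ₜ[K] w) = 1 ⊗ₜ[K] l.prod w := by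
  induction l with
  | nil => rfl
  | cons a l ih =>
    rw [List.map_cons, List.prod_cons, List.prod_cons, Module.End.mul_apply, ih, oddOp_tmul,
      parity_one, Module.End.mul_apply]

theorem action_treeProd {N : ℕ} {e : Fin (N + 1) → Fin (N + 1) → Module.End K M}
    {F : Model 𝓗 (N + 1) →ₐ[K] Module.End K (H ⊗[K] M)}
    (hp : ∀ i x, F (p 𝓗 i x) = pOp M x) (hG : ∀ i j, F (gen 𝓗 i j) = oddOp 𝓗 (e i j))
    (x : H) (f : IncTree N) (v : M) :
    F (p 𝓗 0 x * treeProd (gen 𝓗) f) (1 ⊗ₜ v) = x ⊗ₜ treeProd e f v := by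
  have h1 : F (treeProd (gen 𝓗) f) =
      ((List.ofFn fun j => e (f.parent j) j.succ).map (oddOp 𝓗)).prod := by
    unfold treeProd
    rw [map_list_prod, List.map_ofFn, List.map_ofFn]
    congr 2
    funext j
    exact hG _ _
  rw [map_mul, hp, h1, Module.End.mul_apply, list_map_oddOp_prod, pOp_tmul, mul_one, treeProd]

/-- Evaluation at 1 ⊗ v sends p_0(y) T to y ⊗ T v, and tensors of two independent families are
independent. -/
theorem linearIndependent_p_mul_treeProd (hcomm : GradedCommutative K 𝓗) {N : ℕ} {κ : Type*}
    {y : κ → H} (hy : LinearIndependent K y) :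
    LinearIndependent K fun q : κ × IncTree N =>
      p 𝓗 0 (y q.1) * treeProd (gen 𝓗 (n := N + 1)) q.2 := by
  obtain ⟨M, _, _, e, s, v, he, -, -, hli⟩ := exists_arnoldModule K N
  obtain ⟨F, hp, hG⟩ := exists_action hcomm he
  refine LinearIndependent.of_comp
    (LinearMap.applyₗ ((1 : H) ⊗ₜ[K] v) ∘ₗ F.toLinearMap) ?_
  have h := hy.tmul_of_isDomain hli
  convert h using 1
  · funext q
    exact action_treeProd hp hG _ _ _
  · rfl

end Independence

/-! ### The top component as a span of marked trees -/

section MarkedTrees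

variable {K : Type*} [Field K] {H : Type*} [Ring H] [Algebra K H]
  (𝓗 : ℕ → Submodule K H) {N : ℕ} {κ : Type*}

/-- The span of the tree monomials marked with the elements of the family `y`. -/
def markedSpace (N : ℕ) (y : κ → H) : Submodule K (Model 𝓗 (N + 1)) :=
  Submodule.span K (Set.range fun q : κ × IncTree N => p 𝓗 0 (y q.1) * treeProd (gen 𝓗) q.2)

theorem list_prod_mul_treeProd [CharZero K] (L : List (Fin (N + 1) × H)) (f : IncTree N) :
    (L.map fun a => p 𝓗 a.1 a.2).prod * treeProd (gen 𝓗) f =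
      p 𝓗 0 (L.map Prod.snd).prod * treeProd (gen 𝓗) f := by
  have hp : ∀ (x : H) (j : Fin (N + 1)), p 𝓗 j x * treeProd (gen 𝓗) f =
      p 𝓗 0 x * treeProd (gen 𝓗) f := fun x j =>
    (isArnold_gen 𝓗).mul_treeProd (X := fun i => p 𝓗 i x) (p_gen 𝓗 x) f j
  induction L with
  | nil => simp [p_one]
  | cons a L ih =>
    rw [List.map_cons, List.prod_cons, mul_assoc, ih, ← hp _ a.1, ← mul_assoc, ← p_mul, hp,
      List.map_cons, List.prod_cons]

theorem p_mul_mem_markedSpace {y : κ → H} {x : H} (hx : x ∈ Submodule.span K (Set.range y))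
    {z : Model 𝓗 (N + 1)} (hz : z ∈ Submodule.span K (Set.range (treeProd (gen 𝓗)))) :
    p 𝓗 0 x * z ∈ markedSpace 𝓗 N y := by
  induction hz using Submodule.span_induction with
  | zero => rw [mul_zero]; exact Submodule.zero_mem _
  | add a b _ _ ha hb => rw [mul_add]; exact Submodule.add_mem _ ha hb
  | smul c a _ ha => rw [mul_smul_comm]; exact Submodule.smul_mem _ _ ha
  | mem a ha =>
    obtain ⟨f, rfl⟩ := ha
    rw [← pLinear_apply]
    induction hx using Submodule.span_induction with
    | zero => rw [map_zero, zero_mul]; exact Submodule.zero_mem _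
    | add a b _ _ ha hb => rw [map_add, add_mul]; exact Submodule.add_mem _ ha hb
    | smul c a _ ha => rw [map_smul, smul_mul_assoc]; exact Submodule.smul_mem _ _ ha
    | mem a ha =>
      obtain ⟨k, rfl⟩ := ha
      exact Submodule.subset_span ⟨(k, f), rfl⟩

theorem list_prod_gen_mem [CharZero K] (l : List (Fin (N + 1) × Fin (N + 1)))
    (hl : l.length = N) :
    (l.map fun e => gen 𝓗 e.1 e.2).prod ∈ Submodule.span K (Set.range (treeProd (gen 𝓗))) := by
  have h := (isArnold_gen 𝓗).list_prod_mem_forestSpan (K := K) l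
  rw [hl] at h
  exact forestSpan_le K h

theorem treeSpace_eq (x : H) (hn : 1 ≤ N + 1) :
    treeSpace 𝓗 (N + 1) hn x = markedSpace 𝓗 N fun _ : Unit => x := by
  have hforest : ∀ f : Fin (N + 1) → Fin (N + 1),
      forestMonomial 𝓗 f = forestProd (gen 𝓗) f := by
    intro f
    unfold forestMonomial forestProd
    congr 2
    funext j
    split_ifs with h
    · rw [gen_of_ne 𝓗 h.ne]
    · rfl
  refine congrArg _ (Set.ext fun z => ?_)
  constructor
  · rintro ⟨f, hf, rfl⟩
    obtain ⟨f', h⟩ := exists_incTree (g := gen 𝓗) f hf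
    exact ⟨((), f'), by rw [hforest, h]; rfl⟩
  · rintro ⟨⟨_, f⟩, rfl⟩
    exact ⟨f.toFun, f.toFun_lt, by rw [hforest, forestProd_toFun]; rfl⟩

theorem p_mul_treeProd_mem_component [GradedAlgebra 𝓗] (m i : ℕ) {x : H} (hx : x ∈ 𝓗 i)
    (f : IncTree N) : p 𝓗 0 x * treeProd (gen 𝓗) f ∈
      component 𝓗 (N + 1) m N (N * (2 * (m : ℤ) - 1) + i) := by
  refine Submodule.subset_span ⟨Fin.cons i fun _ => 0, Fin.cons x fun _ => 1,
    List.ofFn fun j => ⟨(f.parent j, j.succ), (f.parent_lt j).ne⟩, ?_, by simp, ?_, ?_⟩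
  · refine Fin.cases hx fun j => ?_
    exact SetLike.GradedOne.one_mem
  · rw [Fin.sum_univ_succ]
    simp
    ring
  · rw [List.ofFn_succ, List.prod_cons, List.map_ofFn, treeProd]
    simp only [Fin.cons_zero, Fin.cons_succ, p_one]
    rw [List.ofFn_const, List.prod_replicate, one_pow, mul_one]
    congr 3
    funext j
    exact gen_of_ne 𝓗 (f.parent_lt j).ne

/-- N exterior factors reduce to trees; there the labels slide to the root and multiply to a single
element of H, whose degree must be i. -/
theorem component_eq [CharZero K] [GradedAlgebra 𝓗] (m i : ℕ) {y : κ → H}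
    (hy : Submodule.span K (Set.range y) = 𝓗 i) :
    component 𝓗 (N + 1) m N (N * (2 * (m : ℤ) - 1) + i) = markedSpace 𝓗 N y := by
  apply le_antisymm
  · rw [component, Submodule.span_le]
    rintro _ ⟨d, x, l, hx, hl, hdeg, rfl⟩
    have hsum : ∑ j, d j = i := by
      have : (∑ j, (d j : ℤ)) = i := by linarith
      exact_mod_cast this
    have hmem : (List.ofFn x).prod ∈ Submodule.span K (Set.range y) := by
      rw [hy, ← hsum, ← List.sum_ofFn]
      exact SetLike.list_prod_ofFn_mem_graded d x hx
    have hG := list_prod_gen_mem 𝓗 (l.map Subtype.val) (by simpa using hl)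
    have hG' : (l.map fun e => G 𝓗 e.1.1 e.1.2 e.2).prod =
        ((l.map Subtype.val).map fun e => gen 𝓗 e.1 e.2).prod := by
      rw [List.map_map]
      congr 2
      funext e
      exact (gen_of_ne 𝓗 e.2).symm
    have hL : ∀ f : IncTree N, (List.ofFn fun j => p 𝓗 j (x j)).prod * treeProd (gen 𝓗) f =
        p 𝓗 0 (List.ofFn x).prod * treeProd (gen 𝓗) f := by
      intro f
      have := list_prod_mul_treeProd 𝓗 (List.ofFn fun j => (j, x j)) f
      rw [List.map_ofFn, List.map_ofFn] at this
      exact this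
    have heq : ∀ z ∈ Submodule.span K (Set.range (treeProd (gen 𝓗))),
        (List.ofFn fun j => p 𝓗 j (x j)).prod * z = p 𝓗 0 (List.ofFn x).prod * z := by
      intro z hz
      induction hz using Submodule.span_induction with
      | zero => simp
      | add a b _ _ ha hb => rw [mul_add, mul_add, ha, hb]
      | smul c a _ ha => rw [mul_smul_comm, mul_smul_comm, ha]
      | mem a ha =>
        obtain ⟨f, rfl⟩ := ha
        exact hL f
    rw [hG', heq _ hG]
    exact p_mul_mem_markedSpace 𝓗 hmem hG
  · rw [markedSpace, Submodule.span_le]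
    rintro _ ⟨⟨k, f⟩, rfl⟩
    refine p_mul_treeProd_mem_component 𝓗 m i ?_ f
    rw [← hy]
    exact Submodule.subset_span ⟨k, rfl⟩

end MarkedTrees

section Basis

variable {K : Type*} [Field K] {H : Type*} [Ring H] [Algebra K H]
  (𝓗 : ℕ → Submodule K H) {N : ℕ} {κ : Type*}

variable [GradedAlgebra 𝓗]

/-- The basis of marked tree monomials. -/
def markedBasis (hcomm : GradedCommutative K 𝓗) (N : ℕ) {y : κ → H}
    (hy : LinearIndependent K y) :
    Module.Basis (κ × IncTree N) K (markedSpace 𝓗 N y) :=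
  Module.Basis.span (linearIndependent_p_mul_treeProd hcomm hy)

theorem markedBasis_apply (hcomm : GradedCommutative K 𝓗) (N : ℕ) {y : κ → H}
    (hy : LinearIndependent K y) (q : κ × IncTree N) :
    (markedBasis 𝓗 hcomm N hy q : Model 𝓗 (N + 1)) =
      p 𝓗 0 (y q.1) * treeProd (gen 𝓗) q.2 :=
  congrArg Subtype.val (Module.Basis.span_apply (linearIndependent_p_mul_treeProd hcomm hy) q)

theorem rep_markedBasis (hcomm : GradedCommutative K 𝓗)
    {A : Equiv.Perm (Fin (N + 1)) → Matrix (IncTree N) (IncTree N) K}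
    (hA : ∀ σ (x : H) (f : IncTree N), permHom 𝓗 σ (p 𝓗 0 x * treeProd (gen 𝓗) f) =
      ∑ f', A σ f' f • (p 𝓗 0 x * treeProd (gen 𝓗) f'))
    {y : κ → H} (hy : LinearIndependent K y) (σ : Equiv.Perm (Fin (N + 1)))
    (q : κ × IncTree N) : rep 𝓗 (N + 1) σ (markedBasis 𝓗 hcomm N hy q) =
      ∑ f', A σ f' q.2 • (markedBasis 𝓗 hcomm N hy (q.1, f') : Model 𝓗 (N + 1)) := by
  simp only [markedBasis_apply]
  exact hA σ _ _

end Basis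

/-! ### Matrices of permutations and characters -/

section Trace

variable {K : Type*} [Field K] [CharZero K] {H : Type*} [Ring H] [Algebra K H]
  (𝓗 : ℕ → Submodule K H) {N : ℕ}

/-- The coefficients are those of the unmarked trees. The mark, moved to σ 0, returns to the root,
so one matrix serves every x. -/
theorem exists_permMatrix (σ : Equiv.Perm (Fin (N + 1))) :
    ∃ A : Matrix (IncTree N) (IncTree N) K, ∀ (x : H) (f : IncTree N),
      permHom 𝓗 σ (p 𝓗 0 x * treeProd (gen 𝓗) f) =
        ∑ f', A f' f • (p 𝓗 0 x * treeProd (gen 𝓗) f') := by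
  have h : ∀ f : IncTree N, ∃ c : IncTree N → K,
      ∑ f', c f' • treeProd (gen 𝓗) f' = permHom 𝓗 σ (treeProd (gen 𝓗) f) := by
    intro f
    rw [← Submodule.mem_span_range_iff_exists_fun]
    have := list_prod_gen_mem 𝓗 (List.ofFn fun j => (σ (f.parent j), σ j.succ)) (by simp)
    rw [List.map_ofFn] at this
    rw [treeProd, map_list_prod, List.map_ofFn]
    have e : (⇑(permHom 𝓗 σ) ∘ fun j => gen 𝓗 (f.parent j) j.succ) =
        (fun a : Fin (N + 1) × Fin (N + 1) => gen 𝓗 a.1 a.2) ∘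
          fun j => (σ (f.parent j), σ j.succ) :=
      funext fun j => permHom_gen 𝓗 σ _ _
    rw [e]
    exact this
  choose c hc using h
  refine ⟨Matrix.of fun f' f => c f f', fun x f => ?_⟩
  rw [map_mul, permHom_p, ← hc, mul_sum]
  refine sum_congr rfl fun f' _ => ?_
  rw [mul_smul_comm, (isArnold_gen 𝓗).mul_treeProd (X := fun i => p 𝓗 i x) (p_gen 𝓗 x)]
  rfl

end Trace

section Character

variable {K V Γ κ ι : Type*} [Field K] [AddCommGroup V] [Module K V] [Group Γ] [Fintype κ]
  [Fintype ι]

theorem character_eq_card_mul_trace {ρ : Representation K Γ V} (S : Subrepresentation ρ)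
    (b : Module.Basis (κ × ι) K S.toSubmodule) {σ : Γ} {A : Matrix ι ι K}
    (hA : ∀ q, ρ σ (b q) = ∑ f', A f' q.2 • (b (q.1, f') : V)) :
    S.toRepresentation.character σ = Fintype.card κ * A.trace := by
  classical
  have happ : ∀ q, S.toRepresentation σ (b q) = ∑ f', A f' q.2 • b (q.1, f') := by
    intro q
    apply Subtype.ext
    rw [AddSubmonoidClass.coe_finsetSum]
    exact hA q
  rw [Representation.character, LinearMap.trace_eq_matrix_trace K b, Matrix.trace]
  have hdiag : ∀ q, (LinearMap.toMatrix b b (S.toRepresentation σ)).diag q = A q.2 q.2 := by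
    intro q
    rw [Matrix.diag_apply, LinearMap.toMatrix_apply, happ, map_sum, Finsupp.finsetSum_apply,
      sum_eq_single q.2]
    · simp
    · intro f' _ hf'
      rw [map_smul, Module.Basis.repr_self, Finsupp.smul_apply, Finsupp.single_apply, if_neg,
        smul_zero]
      intro h
      exact hf' (congrArg Prod.snd h)
    · simp
  rw [sum_congr rfl fun q _ => hdiag q, Fintype.sum_prod_type]
  simp [Matrix.trace]

theorem exists_subrepresentation {ρ : Representation K Γ V} {W : Submodule K V}
    (b : Module.Basis (κ × ι) K W) {A : Γ → Matrix ι ι K}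
    (hA : ∀ σ q, ρ σ (b q) = ∑ f', A σ f' q.2 • (b (q.1, f') : V)) :
    ∃ S : Subrepresentation ρ, S.toSubmodule = W := by
  refine ⟨⟨W, fun σ w hw => ?_⟩, rfl⟩
  have h := b.sum_repr ⟨w, hw⟩
  have h' := congrArg Subtype.val h
  rw [AddSubmonoidClass.coe_finsetSum] at h'
  change _ = w at h'
  rw [← h', map_sum]
  refine Submodule.sum_mem _ fun q _ => ?_
  rw [Submodule.coe_smul, map_smul, hA]
  exact W.smul_mem _ (W.sum_mem fun f' _ => W.smul_mem _ (b _).2)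

theorem hasCharacter_of_basis [Algebra K ℂ] {ρ : Representation K Γ V} {W : Submodule K V}
    (b : Module.Basis (κ × ι) K W) {A : Γ → Matrix ι ι K}
    (hA : ∀ σ q, ρ σ (b q) = ∑ f', A σ f' q.2 • (b (q.1, f') : V)) :
    HasCharacter ρ W fun σ => (Fintype.card κ : ℂ) * algebraMap K ℂ (A σ).trace := by
  refine ⟨Module.Finite.of_basis b, ?_⟩
  obtain ⟨S, rfl⟩ := exists_subrepresentation b hA
  refine ⟨S, rfl, fun σ => ?_⟩
  rw [character_eq_card_mul_trace S b (hA σ), map_mul, map_natCast]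

theorem HasCharacter.unique [Algebra K ℂ] {ρ : Representation K Γ V} {W : Submodule K V}
    {χ χ' : Γ → ℂ} (h : HasCharacter ρ W χ) (h' : HasCharacter ρ W χ') : χ = χ' := by
  obtain ⟨-, S, hS, h⟩ := h
  obtain ⟨-, S', hS', h'⟩ := h'
  obtain rfl : S = S' := Subrepresentation.toSubmodule_injective (hS.trans hS'.symm)
  funext σ
  rw [← h, ← h']

end Character

/-! ### The induced representation and Frobenius reciprocity -/

section Induced

theorem exists_pow_of_mem_cyc {n : ℕ} (c : cyc n) :
    ∃ k : ℕ, c = (⟨finRotate n, Subgroup.mem_zpowers _⟩ : cyc n) ^ k := by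
  obtain ⟨c, hc⟩ := c
  obtain ⟨k, hk⟩ := (mem_powers_iff_mem_zpowers).2 hc
  exact ⟨k, Subtype.ext hk.symm⟩

theorem phiRep_apply (n : ℕ) (hn : 1 ≤ n) (c : cyc n) (a : ℂ) :
    phiRep n hn c a = (phi n hn c : ℂ) * a := rfl

theorem card_quotient_cyc (N : ℕ) :
    Nat.card (Equiv.Perm (Fin (N + 1)) ⧸ cyc (N + 1)) = N.factorial := by
  have h := Subgroup.card_eq_card_quotient_mul_card_subgroup (cyc (N + 1))
  rw [Nat.card_zpowers, orderOf_finRotate _ (Nat.succ_pos N), Nat.card_perm, Nat.card_fin,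
    Nat.factorial_succ, mul_comm] at h
  exact (Nat.eq_of_mul_eq_mul_right (Nat.succ_pos N) h).symm

/-- The space of the representation `Ind φ_n`. -/
abbrev indSpace (N : ℕ) : Type _ :=
  Representation.IndV (cyc (N + 1)).subtype (phiRep (N + 1) (Nat.succ_pos N))

theorem ind_mk_mul (N : ℕ) (c : cyc (N + 1)) (g : Equiv.Perm (Fin (N + 1))) (a : ℂ) :
    Representation.IndV.mk (cyc (N + 1)).subtype (phiRep (N + 1) (Nat.succ_pos N))
        ((c : Equiv.Perm (Fin (N + 1))) * g) ((phi (N + 1) (Nat.succ_pos N) c : ℂ) * a) =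
      Representation.IndV.mk (cyc (N + 1)).subtype (phiRep (N + 1) (Nat.succ_pos N)) g a := by
  have h := Representation.Coinvariants.mk_self_apply
    (Representation.tprod ((Representation.leftRegular ℂ (Equiv.Perm (Fin (N + 1)))).comp
      (cyc (N + 1)).subtype) (phiRep (N + 1) (Nat.succ_pos N))) c (MonoidAlgebra.single g 1 ⊗ₜ a)
  rw [Representation.tprod_apply, TensorProduct.map_tmul] at h
  simpa [phiRep_apply] using h

/-- The coinvariants identify g with c g up to a scalar, so right cosets matter; inverses of
representatives of left cosets represent them. -/
theorem span_ind (N : ℕ) : Submodule.span ℂ (Set.range fun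
    q : Equiv.Perm (Fin (N + 1)) ⧸ cyc (N + 1) => Representation.IndV.mk (cyc (N + 1)).subtype
      (phiRep (N + 1) (Nat.succ_pos N)) (q.out)⁻¹ 1) = ⊤ := by
  rw [eq_top_iff]
  set T := Submodule.span ℂ (Set.range fun
    q : Equiv.Perm (Fin (N + 1)) ⧸ cyc (N + 1) => Representation.IndV.mk (cyc (N + 1)).subtype
      (phiRep (N + 1) (Nat.succ_pos N)) (q.out)⁻¹ 1) with hT
  have key : ∀ g a, Representation.IndV.mk (cyc (N + 1)).subtype
      (phiRep (N + 1) (Nat.succ_pos N)) g a ∈ T := by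
    intro g a
    obtain ⟨c, hc⟩ := QuotientGroup.mk_out_eq_mul (cyc (N + 1)) g⁻¹
    have hg : (c : Equiv.Perm (Fin (N + 1)))⁻¹ * g =
        (QuotientGroup.mk g⁻¹ : Equiv.Perm (Fin (N + 1)) ⧸ cyc (N + 1)).out⁻¹ := by
      rw [hc]; simp
    have h := ind_mk_mul N c⁻¹ g a
    rw [Subgroup.coe_inv, hg] at h
    rw [← h, ← mul_one ((phi (N + 1) _ c⁻¹ : ℂ) * a), ← smul_eq_mul _ (1 : ℂ), map_smul]
    exact T.smul_mem _ (Submodule.subset_span ⟨_, rfl⟩)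
  rintro z -
  induction z using Representation.Coinvariants.induction_on with
  | h x =>
    induction x using TensorProduct.induction_on with
    | zero => rw [map_zero]; exact T.zero_mem
    | add x y hx hy => rw [map_add]; exact T.add_mem hx hy
    | tmul x a =>
      induction x using MonoidAlgebra.induction_linear with
      | zero => rw [TensorProduct.zero_tmul, map_zero]; exact T.zero_mem
      | add x y hx hy => rw [TensorProduct.add_tmul, map_add]; exact T.add_mem hx hy
      | single g b =>
        have := key g (b * a)
        convert this using 1
        change _ = Representation.Coinvariants.mk _ (MonoidAlgebra.single g (1 : ℂ) ⊗ₜ[ℂ] (b * a))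
        rw [← smul_eq_mul b a, TensorProduct.tmul_smul, TensorProduct.smul_tmul']
        simp

instance (N : ℕ) : Module.Finite ℂ (indSpace N) :=
  Module.finite_def.2 (Submodule.fg_def.2 ⟨_, Set.finite_range _, span_ind N⟩)

theorem finrank_ind_le (N : ℕ) : Module.finrank ℂ (indSpace N) ≤ N.factorial := by
  classical
  have : Fintype (Equiv.Perm (Fin (N + 1)) ⧸ cyc (N + 1)) := Fintype.ofFinite _
  have h := finrank_range_le_card (R := ℂ) (fun
    q : Equiv.Perm (Fin (N + 1)) ⧸ cyc (N + 1) => Representation.IndV.mk (cyc (N + 1)).subtype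
      (phiRep (N + 1) (Nat.succ_pos N)) (q.out)⁻¹ 1)
  rw [Set.finrank, span_ind, finrank_top, ← Nat.card_eq_fintype_card, card_quotient_cyc] at h
  exact h

/-- Frobenius reciprocity for a vector on which the cyclic group acts through `ε φ_n`: if it
generates a representation of dimension `N!`, the character is `ε Ind φ_n`. -/
theorem character_eq_topCharacter {N : ℕ} {V : Type*} [AddCommGroup V] [Module ℂ V]
    [Module.Finite ℂ V] (ρ : Representation ℂ (Equiv.Perm (Fin (N + 1))) V)
    (hdim : Module.finrank ℂ V = N.factorial) (r : V)
    (hr : (-1 : ℂ) ^ N • ρ (finRotate (N + 1)) r = (zeta (N + 1) : ℂ) • r)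
    (hspan : ∀ U : Submodule ℂ V, r ∈ U → (∀ σ, ∀ u ∈ U, ρ σ u ∈ U) → U = ⊤)
    (σ : Equiv.Perm (Fin (N + 1))) :
    ρ.character σ = topCharacter (N + 1) (Nat.succ_pos N) σ := by
  let sgn : Equiv.Perm (Fin (N + 1)) → ℂ := fun σ => ((Equiv.Perm.sign σ : ℤ) : ℂ)
  have sgn_mul : ∀ σ τ, sgn (σ * τ) = sgn σ * sgn τ := fun σ τ => by simp [sgn]
  have sgn_sq : ∀ σ, sgn σ * sgn σ = 1 := fun σ => by
    rcases Int.units_eq_one_or (Equiv.Perm.sign σ) with h | h <;> simp [sgn, h]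
  -- Twisting by the sign, which is (-1)^N on the long cycle, makes r an eigenvector of c_n with
  -- eigenvalue ζ.
  let ρ' : Representation ℂ (Equiv.Perm (Fin (N + 1))) V :=
    { toFun := fun σ => sgn σ • ρ σ
      map_one' := by simp [sgn]
      map_mul' := fun σ τ => by rw [sgn_mul, map_mul, smul_mul_smul_comm] }
  have ρ'_apply : ∀ σ v, ρ' σ v = sgn σ • ρ σ v := fun _ _ => rfl
  have hc : ρ' (finRotate (N + 1)) r = (zeta (N + 1) : ℂ) • r := by
    rw [ρ'_apply, ← hr]
    simp [sgn, sign_finRotate]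
  have hphi : ∀ c : cyc (N + 1), ρ' c r = (phi (N + 1) (Nat.succ_pos N) c : ℂ) • r := by
    intro c
    obtain ⟨k, rfl⟩ := exists_pow_of_mem_cyc c
    induction k with
    | zero => simp
    | succ k ih =>
      rw [pow_succ', Subgroup.coe_mul, map_mul, Module.End.mul_apply, ih, map_smul, hc, map_mul,
        Units.val_mul, smul_smul, phi_gen, mul_comm]
      rfl
  -- The inverse g⁻¹ appears because σ acts on the induced space by g ↦ g σ⁻¹.
  let Ψ : indSpace N →ₗ[ℂ] V := Representation.Coinvariants.lift _
    (TensorProduct.lift ((Finsupp.lift _ ℂ _ fun g => LinearMap.toSpanSingleton ℂ V (ρ' g⁻¹ r)) ∘ₗ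
      (MonoidAlgebra.coeffLinearEquiv ℂ).toLinearMap)) (by
      intro c
      ext g
      have h : ρ' g⁻¹ (ρ' (c : Equiv.Perm (Fin (N + 1)))⁻¹ r) =
          (phi (N + 1) (Nat.succ_pos N) c⁻¹ : ℂ) • ρ' g⁻¹ r := by
        rw [← Subgroup.coe_inv, hphi, map_smul]
      simp [phiRep_apply, smul_smul, h])
  have hΨ : ∀ g a, Ψ (Representation.IndV.mk _ _ g a) = a • ρ' g⁻¹ r := by
    intro g a
    simp [Ψ]
  have hcomm : ∀ σ z, Ψ (Representation.ind _ _ σ z) = ρ' σ (Ψ z) := by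
    intro σ
    have : Ψ ∘ₗ Representation.ind _ _ σ = ρ' σ ∘ₗ Ψ := by
      refine Representation.IndV.hom_ext _ _ fun g => LinearMap.ext fun a => ?_
      change Ψ (Representation.ind _ _ σ (Representation.IndV.mk _ _ g a)) =
        ρ' σ (Ψ (Representation.IndV.mk _ _ g a))
      rw [Representation.ind_mk, hΨ, hΨ, map_smul, mul_inv_rev, inv_inv, map_mul,
        Module.End.mul_apply]
    exact fun z => LinearMap.congr_fun this z
  have hsurj : Function.Surjective Ψ := by
    rw [← LinearMap.range_eq_top]
    refine hspan _ ⟨Representation.IndV.mk _ _ 1 1, by rw [hΨ]; simp⟩ ?_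
    rintro σ _ ⟨z, rfl⟩
    refine ⟨sgn σ • Representation.ind _ _ σ z, ?_⟩
    rw [map_smul, hcomm, ρ'_apply, smul_smul, sgn_sq, one_smul]
  have hinj : Function.Injective Ψ :=
    (LinearMap.injective_iff_surjective_of_finrank_eq_finrank (le_antisymm
      (by rw [hdim]; exact finrank_ind_le N) (LinearMap.finrank_le_finrank_of_surjective hsurj))).2
      hsurj
  let Φ : indSpace N ≃ₗ[ℂ] V := LinearEquiv.ofBijective Ψ ⟨hinj, hsurj⟩
  have hconj : ρ' σ = Φ.conj (Representation.ind (cyc (N + 1)).subtype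
      (phiRep (N + 1) (Nat.succ_pos N)) σ) := by
    ext v
    obtain ⟨z, rfl⟩ := Φ.surjective v
    rw [LinearEquiv.conj_apply_apply, LinearEquiv.symm_apply_apply]
    exact (hcomm σ z).symm
  have htr : LinearMap.trace ℂ V (ρ' σ) = (Representation.ind (cyc (N + 1)).subtype
      (phiRep (N + 1) (Nat.succ_pos N))).character σ := by
    rw [hconj, LinearMap.trace_conj', Representation.character]
  have hρ : ρ σ = sgn σ • ρ' σ := by
    ext v
    rw [LinearMap.smul_apply, ρ'_apply, smul_smul, sgn_sq, one_smul]
  rw [topCharacter, Representation.character, hρ, map_smul, htr, smul_eq_mul]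

end Induced

theorem IsArnold.map {α R S F : Type*} [Ring R] [Ring S] [FunLike F R S] [RingHomClass F R S]
    {g : α → α → R} (hg : IsArnold g) (φ : F) : IsArnold fun i j => φ (g i j) where
  symm i j := by rw [hg.symm]
  diag i := by rw [hg.diag, map_zero]
  anticomm i j k l := by rw [← map_mul, hg.anticomm, map_neg, map_mul]
  cyclic i j k := by
    rw [← map_mul, ← map_mul, ← map_mul, ← map_add, ← map_add, hg.cyclic, map_zero]

/-- K need not contain ζ, so the eigenvector lives over ℂ. Traces survive the extension of scalars,
and flatness embeds ℂ ⊗ W in ℂ ⊗ V. -/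
theorem hasCharacter_of_baseChange {K V : Type*} [Field K] [Algebra K ℂ] [AddCommGroup V]
    [Module K V] {N : ℕ} {ρ : Representation K (Equiv.Perm (Fin (N + 1))) V}
    {W : Submodule K V} [hfin : Module.Finite K W]
    (hW : ∃ S : Subrepresentation ρ, S.toSubmodule = W)
    (hdim : Module.finrank K W = N.factorial) (r : ℂ ⊗[K] V)
    (hr : r ∈ LinearMap.range (W.subtype.baseChange ℂ))
    (heig : (-1 : ℂ) ^ N • (ρ (finRotate (N + 1))).baseChange ℂ r = (zeta (N + 1) : ℂ) • r)
    (hspan : ∀ U : Submodule ℂ (ℂ ⊗[K] V), r ∈ U →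
      (∀ σ, ∀ u ∈ U, (ρ σ).baseChange ℂ u ∈ U) → ∀ w ∈ W, 1 ⊗ₜ w ∈ U) :
    HasCharacter ρ W (topCharacter (N + 1) (Nat.succ_pos N)) := by
  obtain ⟨S, rfl⟩ := hW
  refine ⟨hfin, S, rfl, fun σ => ?_⟩
  set J := S.toSubmodule.subtype.baseChange ℂ with hJ
  have hJinj : Function.Injective J :=
    Module.Flat.lTensor_preserves_injective_linearMap _ S.toSubmodule.injective_subtype
  let ρ₀ : Representation ℂ (Equiv.Perm (Fin (N + 1))) (ℂ ⊗[K] S.toSubmodule) :=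
    { toFun := fun σ => (S.toRepresentation σ).baseChange ℂ
      map_one' := by rw [map_one]; exact LinearMap.baseChange_id
      map_mul' := fun σ τ => by rw [map_mul]; exact LinearMap.baseChange_comp _ _ }
  have hJρ : ∀ σ z, J (ρ₀ σ z) = (ρ σ).baseChange ℂ (J z) := by
    intro σ z
    induction z using TensorProduct.induction_on with
    | zero => simp only [map_zero]
    | add a b ha hb => rw [map_add, map_add, ha, hb, map_add, map_add]
    | tmul a w => rfl
  obtain ⟨r₀, rfl⟩ := hr
  have hdim' : Module.finrank ℂ (ℂ ⊗[K] S.toSubmodule) = N.factorial := by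
    rw [Module.finrank_baseChange, hdim]
  rw [← character_eq_topCharacter ρ₀ hdim' r₀ ?_ ?_ σ]
  · exact (LinearMap.trace_baseChange _ ℂ).symm
  · apply hJinj
    rw [map_smul, map_smul, hJρ, heig]
  · intro U hU hst
    rw [eq_top_iff]
    rintro z -
    have h := hspan (U.map J) ⟨r₀, hU, rfl⟩ (by
      rintro σ _ ⟨u, hu, rfl⟩
      exact ⟨ρ₀ σ u, hst σ u hu, hJρ σ u⟩)
    induction z using TensorProduct.induction_on with
    | zero => exact U.zero_mem
    | add a b ha hb => exact U.add_mem ha hb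
    | tmul a w =>
      obtain ⟨u, hu, he⟩ := h w w.2
      have : u = 1 ⊗ₜ w := hJinj he
      subst this
      have := U.smul_mem a hu
      rwa [TensorProduct.smul_tmul', smul_eq_mul, mul_one] at this

theorem map_finRotate_finRange (N : ℕ) :
    (List.finRange (N + 1)).map (finRotate (N + 1)) = (List.finRange (N + 1)).rotate 1 := by
  apply List.ext_getElem
  · simp
  · intro i h1 h2
    rw [List.getElem_map, List.getElem_rotate, List.getElem_finRange, List.getElem_finRange,
      finRotate_apply]
    apply Fin.ext
    simp [Fin.val_add]

/-- The cyclic sum of paths is an eigenvector of the cyclic rotation. -/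
theorem IsArnold.rotate_cycSum {N : ℕ} {L R : Type*} [Field L] [Ring R] [Algebra L R]
    {g : Fin (N + 1) → Fin (N + 1) → R} (hg : IsArnold g) {X : Fin (N + 1) → R}
    (hX : ∀ i j, X j * g i j = X i * g i j) (φ : R →ₐ[L] R)
    (hφg : ∀ i j, φ (g i j) = g (finRotate (N + 1) i) (finRotate (N + 1) j))
    (hφX : ∀ i, φ (X i) = X (finRotate (N + 1) i)) {t : L} (ht : t ^ (N + 1) = 1) :
    (-1 : L) ^ N • t • φ (X 0 * cycSum t g (List.finRange (N + 1))) =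
      X 0 * cycSum t g (List.finRange (N + 1)) := by
  have hpath : ∀ l, φ (pathProd g l) = pathProd g (l.map (finRotate (N + 1))) := fun l =>
    map_pathProd φ g _ hφg l
  have hXp : ∀ i k, X i * pathProd g ((List.finRange (N + 1)).rotate k) =
      X 0 * pathProd g ((List.finRange (N + 1)).rotate k) := by
    intro i k
    obtain ⟨a, l, hl⟩ : ∃ a l, (List.finRange (N + 1)).rotate k = a :: l :=
      List.exists_cons_of_ne_nil (by
        rw [Ne, List.rotate_eq_nil_iff, List.finRange_succ]; simp)
    have hmem : ∀ j, j ∈ a :: l := fun j => by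
      rw [← hl, List.mem_rotate]; exact List.mem_finRange j
    rw [hl, hg.mul_pathProd_cons hX a l i (hmem i), hg.mul_pathProd_cons hX a l 0 (hmem 0)]
  set F : ℕ → R := fun j => (t ^ j * (-1) ^ (N * (j + 1))) •
    (X 0 * pathProd g ((List.finRange (N + 1)).rotate (j + 1))) with hF
  have h1 : X 0 * cycSum t g (List.finRange (N + 1)) = ∑ j ∈ range (N + 1), F j := by
    rw [cycSum, mul_sum, List.length_finRange]
    exact sum_congr rfl fun j _ => mul_smul_comm _ _ _
  have h2 : ∀ j, (-1 : L) ^ N • t • φ (F j) = F (j + 1) := by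
    intro j
    simp only [hF]
    rw [map_smul, map_mul, hφX, hpath, List.map_rotate, map_finRotate_finRange, List.rotate_rotate,
      hXp, smul_smul, smul_smul, add_comm 1 (j + 1)]
    congr 1
    ring
  -- The shifted sum closes up because t^(N+1) = 1 and N(N+1) is even.
  have h3 : F (N + 1) = F 0 := by
    simp only [hF]
    have hl := List.rotate_length (List.finRange (N + 1))
    rw [List.length_finRange] at hl
    rw [ht, pow_zero, ← List.rotate_rotate _ (N + 1) 1, hl]
    congr 2
    rw [show N * (N + 1 + 1) = N * (N + 1) + N * (0 + 1) by ring, pow_add,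
      (Nat.even_mul_succ_self N).neg_one_pow, one_mul]
  rw [h1, map_sum, smul_sum, smul_sum, sum_congr rfl fun j _ => h2 j]
  have h4 := sum_range_succ F (N + 1)
  rw [sum_range_succ', h3] at h4
  exact add_right_cancel h4

theorem pathProd_mem_span {K : Type*} [Field K] [CharZero K] {H : Type*} [Ring H] [Algebra K H]
    (𝓗 : ℕ → Submodule K H) {N : ℕ} {l : List (Fin (N + 1))} (hl : l.length = N + 1) :
    pathProd (gen 𝓗) l ∈ Submodule.span K (Set.range (treeProd (gen 𝓗))) := by
  have key : ∀ l : List (Fin (N + 1)), ∃ L : List (Fin (N + 1) × Fin (N + 1)),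
      L.length = l.length - 1 ∧ pathProd (gen 𝓗) l = (L.map fun e => gen 𝓗 e.1 e.2).prod := by
    intro l
    induction l with
    | nil => exact ⟨[], rfl, rfl⟩
    | cons a l ih =>
      cases l with
      | nil => exact ⟨[], rfl, rfl⟩
      | cons b l =>
        obtain ⟨L, hL, e⟩ := ih
        refine ⟨(a, b) :: L, ?_, ?_⟩
        · simp [hL]
        · rw [pathProd_cons_cons, e, List.map_cons, List.prod_cons]
  obtain ⟨L, hL, e⟩ := key l
  rw [e]
  exact list_prod_gen_mem 𝓗 L (by omega)

theorem exists_markedSubrepresentation {K : Type*} [Field K] [CharZero K] {H : Type*} [Ring H]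
    [Algebra K H] (𝓗 : ℕ → Submodule K H) [GradedAlgebra 𝓗] {N : ℕ}
    (hcomm : GradedCommutative K 𝓗) {κ : Type*} [Fintype κ] {y : κ → H} (hy : LinearIndependent K y) :
    ∃ S : Subrepresentation (rep 𝓗 (N + 1)), S.toSubmodule = markedSpace 𝓗 N y := by
  choose A hA using exists_permMatrix (K := K) (N := N) 𝓗
  exact exists_subrepresentation (markedBasis 𝓗 hcomm N hy) (rep_markedBasis 𝓗 hcomm hA hy)

/-! ### The characters of the marked spaces -/

section Model

variable {K : Type*} [Field K] [Algebra K ℂ] {H : Type*} [Ring H] [Algebra K H]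
  (𝓗 : ℕ → Submodule K H) {N : ℕ}

/-- The action of the symmetric group on the complexified Kriz model. -/
def complexAct (n : ℕ) :
    Equiv.Perm (Fin n) →* (ℂ ⊗[K] Model 𝓗 n →ₐ[ℂ] ℂ ⊗[K] Model 𝓗 n) where
  toFun σ := Algebra.TensorProduct.map (AlgHom.id ℂ ℂ) (permHom 𝓗 σ)
  map_one' := by
    have : permHom 𝓗 (1 : Equiv.Perm (Fin n)) = AlgHom.id K _ := algHom_ext 𝓗 (by simp) (by simp)
    rw [this]
    exact Algebra.TensorProduct.map_id
  map_mul' σ τ := by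
    have : permHom 𝓗 (σ * τ) = (permHom 𝓗 σ).comp (permHom 𝓗 τ) :=
      algHom_ext 𝓗 (by simp) (by simp)
    rw [this]
    exact Algebra.TensorProduct.map_id_comp _ _

theorem complexAct_tmul (n : ℕ) (σ : Equiv.Perm (Fin n)) (a : ℂ) (z : Model 𝓗 n) :
    complexAct 𝓗 n σ (a ⊗ₜ z) = a ⊗ₜ permHom 𝓗 σ z := rfl

theorem rep_baseChange (n : ℕ) (σ : Equiv.Perm (Fin n)) (z : ℂ ⊗[K] Model 𝓗 n) :
    (rep 𝓗 n σ).baseChange ℂ z = complexAct 𝓗 n σ z := rfl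

variable [GradedAlgebra 𝓗]

theorem hasCharacter_markedSpace_single (hcomm : GradedCommutative K 𝓗) {x : H} (hx : x ≠ 0) :
    HasCharacter (rep 𝓗 (N + 1)) (markedSpace 𝓗 N fun _ : Unit => x)
      (topCharacter (N + 1) (Nat.succ_pos N)) := by
  have : CharZero K := (algebraMap K ℂ).charZero
  have hli : LinearIndependent K fun _ : Unit => x :=
    LinearIndependent.of_subsingleton () hx
  have b := markedBasis 𝓗 hcomm N hli
  have hfin : Module.Finite K (markedSpace 𝓗 N fun _ : Unit => x) := Module.Finite.of_basis b
  have hdim : Module.finrank K (markedSpace 𝓗 N fun _ : Unit => x) = N.factorial := by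
    rw [Module.finrank_eq_card_basis b, Fintype.card_prod, card_incTree]
    simp
  have hg := (isArnold_gen 𝓗 (n := N + 1)).map
    (Algebra.TensorProduct.includeRight : Model 𝓗 (N + 1) →ₐ[K] ℂ ⊗[K] Model 𝓗 (N + 1))
  set g : Fin (N + 1) → Fin (N + 1) → ℂ ⊗[K] Model 𝓗 (N + 1) := fun i j =>
    (Algebra.TensorProduct.includeRight : Model 𝓗 (N + 1) →ₐ[K] ℂ ⊗[K] Model 𝓗 (N + 1))
      (gen 𝓗 i j) with hgdef
  let X : Fin (N + 1) → ℂ ⊗[K] Model 𝓗 (N + 1) := fun i => 1 ⊗ₜ p 𝓗 i x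
  have hX : ∀ i j, X j * g i j = X i * g i j := by
    intro i j
    simp only [X, hgdef, Algebra.TensorProduct.includeRight_apply,
      Algebra.TensorProduct.tmul_mul_tmul, p_gen]
  have hact_g : ∀ σ i j, complexAct 𝓗 (N + 1) σ (g i j) = g (σ i) (σ j) := by
    intro σ i j
    simp only [hgdef, Algebra.TensorProduct.includeRight_apply, complexAct_tmul, permHom_gen]
  have hact_X : ∀ σ i, complexAct 𝓗 (N + 1) σ (X i) = X (σ i) := by
    intro σ i
    simp only [X, complexAct_tmul, permHom_p]
  have hprim : IsPrimitiveRoot (zeta (N + 1) : ℂ) (N + 1) :=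
    Complex.isPrimitiveRoot_exp (N + 1) (Nat.succ_ne_zero N)
  -- The cyclic sum has twisted eigenvalue t⁻¹, so eigenvalue ζ requires t = ζ⁻¹; primitivity of ζ
  -- gives t^k ≠ 1 for 0 < k ≤ N.
  set t : ℂ := (zeta (N + 1) : ℂ)⁻¹ with ht
  have ht1 : t ^ (N + 1) = 1 := hprim.inv.pow_eq_one
  have ht2 : ∀ k, 0 < k → k < N + 1 → t ^ k ≠ 1 := fun k h0 h1 =>
    hprim.inv.pow_ne_one_of_pos_of_lt h0.ne' h1
  have hpath : ∀ l, pathProd g l = 1 ⊗ₜ pathProd (gen 𝓗) l := by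
    intro l
    have := map_pathProd
      (Algebra.TensorProduct.includeRight : Model 𝓗 (N + 1) →ₐ[K] ℂ ⊗[K] Model 𝓗 (N + 1))
      g id (fun _ _ => rfl) l
    rw [List.map_id] at this
    exact this.symm
  have htree : ∀ f, treeProd g f = 1 ⊗ₜ treeProd (gen 𝓗) f := by
    intro f
    have := map_list_prod
      (Algebra.TensorProduct.includeRight : Model 𝓗 (N + 1) →ₐ[K] ℂ ⊗[K] Model 𝓗 (N + 1))
      (List.ofFn fun j => gen 𝓗 (f.parent j) j.succ)
    rw [List.map_ofFn] at this
    exact this.symm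
  refine hasCharacter_of_baseChange (exists_markedSubrepresentation 𝓗 hcomm hli) hdim
    (X 0 * cycSum t g (List.finRange (N + 1))) ?_ ?_ ?_
  · rw [cycSum, mul_sum]
    refine Submodule.sum_mem _ fun j _ => ?_
    rw [mul_smul_comm]
    refine Submodule.smul_mem _ _ ?_
    rw [hpath, Algebra.TensorProduct.tmul_mul_tmul, mul_one]
    have hmem : p 𝓗 0 x * pathProd (gen 𝓗) ((List.finRange (N + 1)).rotate (j + 1)) ∈
        markedSpace 𝓗 N fun _ : Unit => x :=
      p_mul_mem_markedSpace 𝓗 (Submodule.subset_span ⟨(), rfl⟩)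
        (pathProd_mem_span 𝓗 (by simp))
    exact ⟨1 ⊗ₜ ⟨_, hmem⟩, rfl⟩
  · have h := hg.rotate_cycSum hX (complexAct 𝓗 (N + 1) (finRotate (N + 1)))
      (hact_g _) (hact_X _) ht1
    rw [rep_baseChange]
    conv_rhs => rw [← h]
    rw [smul_comm _ t, smul_smul, ht, mul_inv_cancel₀ (Units.ne_zero _), one_smul]
  · intro U hU hst w hw
    have hmem := hg.mul_treeProd_mem hX (complexAct 𝓗 (N + 1)) hact_g hact_X
      (fun σ u hu => hst σ u hu) ht2 hU
    induction hw using Submodule.span_induction with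
    | zero => rw [TensorProduct.tmul_zero]; exact U.zero_mem
    | add a b _ _ ha hb => rw [TensorProduct.tmul_add]; exact U.add_mem ha hb
    | smul c a _ ha =>
      rw [TensorProduct.tmul_smul, ← algebraMap_smul ℂ c]
      exact U.smul_mem _ ha
    | mem a ha =>
      obtain ⟨⟨_, f⟩, rfl⟩ := ha
      have := hmem f
      rw [htree, Algebra.TensorProduct.tmul_mul_tmul, mul_one] at this
      exact this

theorem hasCharacter_markedSpace (hcomm : GradedCommutative K 𝓗) {κ : Type*} [Fintype κ]
    {y : κ → H} (hy : LinearIndependent K y) :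
    HasCharacter (rep 𝓗 (N + 1)) (markedSpace 𝓗 N y) fun σ =>
      (Fintype.card κ : ℂ) * topCharacter (N + 1) (Nat.succ_pos N) σ := by
  have : CharZero K := (algebraMap K ℂ).charZero
  choose A hA using exists_permMatrix (K := K) (N := N) 𝓗
  have h := hasCharacter_of_basis (markedBasis 𝓗 hcomm N hy)
    (rep_markedBasis 𝓗 hcomm hA hy)
  -- Without marks both characters vanish. Otherwise one mark suffices to identify the trace of the
  -- common matrix.
  rcases isEmpty_or_nonempty κ with hκ | ⟨⟨k⟩⟩
  · simpa using h
  · have h1 := hasCharacter_markedSpace_single (N := N) 𝓗 hcomm (hy.ne_zero k)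
    have hli : LinearIndependent K fun _ : Unit => y k :=
      LinearIndependent.of_subsingleton () (hy.ne_zero k)
    have h2 := hasCharacter_of_basis (markedBasis 𝓗 hcomm N hli)
      (rep_markedBasis 𝓗 hcomm hA hli)
    have h3 := h1.unique h2
    simp only [Fintype.card_unit, Nat.cast_one, one_mul] at h3
    rw [h3]
    exact h

end Model

end Kriz

end

theorem proposition3p4
    {K : Type*} [Field K] [Algebra K ℂ]
    {H : Type*} [Ring H] [Algebra K H] [Module.Finite K H]
    (𝓗 : ℕ → Submodule K H) [GradedAlgebra 𝓗] (hcomm : Kriz.GradedCommutative K 𝓗)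
    {ι : Type*} (x : Module.Basis ι K H) (deg : ι → ℕ) (hx : ∀ h, x h ∈ 𝓗 (deg h))
    (m n : ℕ) (hn : 1 ≤ n) :
    (∀ h : ι,
      Kriz.treeSpace 𝓗 n hn (x h) ≤
        Kriz.component 𝓗 n m (n - 1) (((n : ℤ) - 1) * (2 * (m : ℤ) - 1) + deg h) ∧
      Kriz.HasCharacter (Kriz.rep 𝓗 n) (Kriz.treeSpace 𝓗 n hn (x h))
        (Kriz.topCharacter n hn)) ∧
    (∀ i : ℕ,
      Kriz.HasCharacter (Kriz.rep 𝓗 n)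
        (Kriz.component 𝓗 n m (n - 1) (((n : ℤ) - 1) * (2 * (m : ℤ) - 1) + i))
        (fun σ => (Module.finrank K (𝓗 i) : ℂ) * Kriz.topCharacter n hn σ)) := by
  have : CharZero K := (algebraMap K ℂ).charZero
  obtain ⟨N, rfl⟩ : ∃ N, n = N + 1 := ⟨n - 1, by omega⟩
  rw [Nat.add_sub_cancel, Nat.cast_succ, add_sub_cancel_right]
  refine ⟨fun h => ?_, fun i => ?_⟩
  · rw [Kriz.treeSpace_eq]
    refine ⟨?_, Kriz.hasCharacter_markedSpace_single 𝓗 hcomm (x.ne_zero h)⟩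
    rw [Kriz.markedSpace, Submodule.span_le]
    rintro _ ⟨⟨_, f⟩, rfl⟩
    exact Kriz.p_mul_treeProd_mem_component 𝓗 m (deg h) (hx h) f
  -- Any basis of H^i will do here, and its cardinality is β_i; the given basis of H plays no role.
  · let b := Module.finBasis K (𝓗 i)
    have hli : LinearIndependent K fun k => (b k : H) :=
      b.linearIndependent.map' (𝓗 i).subtype (𝓗 i).ker_subtype
    have hspan : Submodule.span K (Set.range fun k => (b k : H)) = 𝓗 i := by
      have h := congrArg (Submodule.map (𝓗 i).subtype) b.span_eq
      rw [Submodule.map_span, ← Set.range_comp, Submodule.map_top, Submodule.range_subtype] at h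
      exact h
    rw [Kriz.component_eq 𝓗 m i hspan]
    simpa using Kriz.hasCharacter_markedSpace (N := N) 𝓗 hcomm hli
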